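/- Let $\omega=\frac{1+\sqrt{-3}}{2}$. Call $(a,b)$ an Eisenstein pair if $a,b$ are positive integers such that $a^2+ab+b^2$ is a perfect square. Let $A$ be the set of all $z=\alpha+\beta\omega$ with real $\alpha,\beta\ge 0$ and $\alpha^2+\alpha\beta+\beta^2=1$. For $z\in A$ let $\ell(z)=\{tz : t\ge 0\}$ be the half-line from $0$ through $z$, and put $$\delta(z)=\liminf_{|a+b\omega|\to\infty}\operatorname{dist}\bigl(a+b\omega,\ \ell(z)\bigr)\in[0,\infty],$$ where $(a,b)$ runs over the Eisenstein pairs and $\operatorname{dist}$ is the shortest Euclidean distance in $\mathbb{C}$. Then, for $z\in A$, $\delta(z)=\infty$ if and only if $z=1$ or $z=\omega$, and the five largest elements of the set $\{\delta(z) : z\in A,\ \delta(z)<\infty\}$, in decreasing order and each with a point $z\in A$ at which it is attained, are $$\begin{array}{ll} \delta(z) & z\\ \hline \frac12 & \frac{1}{\sqrt3}+\frac{1}{\sqrt3}\,\omega\\[2pt] \sqrt{\frac{3}{13}} & \frac12+\frac{-1+\sqrt{13}}{4}\,\omega\\[2pt] \frac{5}{\sqrt{133}} & \frac{10}{\sqrt{399}}+\frac{13}{\sqrt{399}}\,\omega\\[2pt]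 \frac{109}{2\sqrt{15841}} & \frac{109}{\sqrt{47523}}+\frac{142}{\sqrt{47523}}\,\omega\\[2pt] \frac{1189}{2\sqrt{1884961}} & \frac{1189}{\sqrt{5654883}}+\frac{1549}{\sqrt{5654883}}\,\omega \end{array}$$ -/

import Mathlib

open Filter
open scoped ENNReal

noncomputable section

namespace Eisenstein

/-- The number `ω = (1 + √-3) / 2`. -/
def omega : ℂ := (1 + (Real.sqrt 3 : ℂ) * Complex.I) / 2

/-- An Eisenstein pair: positive integers `a`, `b` such that `a² + ab + b²` is a perfect square.
Coprimality is not required. -/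
def IsEisensteinPair (p : ℕ × ℕ) : Prop :=
  0 < p.1 ∧ 0 < p.2 ∧ IsSquare (p.1 ^ 2 + p.1 * p.2 + p.2 ^ 2)

/-- The set of Eisenstein pairs, as a type. -/
abbrev EPair : Type := {p : ℕ × ℕ // IsEisensteinPair p}

/-- The point `a + b ω` of the complex plane attached to the Eisenstein pair `(a, b)`. -/
def point (p : EPair) : ℂ := (p.1.1 : ℂ) + (p.1.2 : ℂ) * omega

/-- The half-line that begins at `0` and passes through `z`. -/
def ray (z : ℂ) : Set ℂ := {w | ∃ t : ℝ, 0 ≤ t ∧ w = (t : ℂ) * z}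

/-- The shortest Euclidean distance from `a + b ω` to the half-line through `z`,
as an element of `[0, ∞]`. -/
def delta' (z : ℂ) (p : EPair) : ℝ≥0∞ := Metric.infEDist (point p) (ray z)

/-- The lower limit of `delta' z (a, b)` as `|a + b ω| → ∞` over the Eisenstein pairs `(a, b)`.
It takes values in `[0, ∞]`. -/
def delta (z : ℂ) : ℝ≥0∞ :=
  liminf (fun p : EPair => delta' z p) (comap (fun p : EPair => ‖point p‖) atTop)

/-- The points `α + β ω` with real `α, β ≥ 0` and `α² + αβ + β² = 1`; this is the arc
`0 ≤ arg z ≤ π / 3` of the unit circle. -/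
def arc : Set ℂ :=
  {z | ∃ α β : ℝ, 0 ≤ α ∧ 0 ≤ β ∧ α ^ 2 + α * β + β ^ 2 = 1 ∧ z = (α : ℂ) + (β : ℂ) * omega}

/-- The set of all finite values that `delta` takes on the arc. -/
def values : Set ℝ≥0∞ := {x | ∃ z ∈ arc, delta z = x ∧ x ≠ ∞}

end Eisenstein

end

/-! A direction other than `1` and `ω` corresponds to a parameter `x > 0` (`arcPoint`). The
Eisenstein pairs are the multiples of the pairs `(p² + 2pq, 2pq + 3q²)` with `p, q` coprime, divided
by `3` when `3 ∣ p` (`exists_param`). The distance from the `d`-fold pair to the half-line is `√3 ·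
d · height x y (p, q)` with `y = conjParam x` (`delta'_arcPoint`). So for irrational `x` the lower
limit is `√3` times the constant of approximation of `x` by fractions `p / q`, where those with `3 ∣
p` carry weight `1/3`; for rational `x` it is `0`. The constant does not depend on `y`
(`goodPairs_finite_change`). It is invariant under the level 3 Möbius maps in `Branch` and under `x
↦ 3 / x`, so the task is to find the top of a Markoff-type spectrum.

Expand `x` along five branches, onto `(0, 1)`, `(1, 3/2)`, `(3/2, 2)`, `(2, 3)`, `(3, ∞)`, and carry
a backward variable `y`. If only finitely many fractions have height at most `1/4`, then from some
time on `(1, 0)` and `(0, 1)` have height above `1/4`, that is, `x + y < 4` and `3/x + 3/y < 4`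
(`Orbit.eventually_lt_height`, `Orbit.tight`). These inequalities leave only the digits 2, 3, 4 and
forbid 24. Once a 2 has occurred after time 0, every later 3 is isolated, and comparing the forward
and backward continued fractions around a 3 shows that neighbouring runs of 2 have the same even
length (`TightOrbit.run_eq`). Up to `x ↦ 3 / x`, a tail of `x` is therefore fixed by `branch₂` or by
some `word j` (`TightOrbit.exists_special`).

Such fixed points are roots of integral forms. An automorph of the form bounds the constant from
above (`IsRootPair.constLE`), and a finite cycle of reduced forms bounds it from below
(`form_lower_bound`). The result is `1 / √13` for `branch₂`, and for `word j` it is `peak j = N /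
(2√(4N² - 1))` with `N = 1, 10, 109, 1189, …`; for `j > 3` the upper bound suffices. The peaks
decrease and stay above `1/4`, so everything not listed has constant at most `peak 3`. At `1` and
`ω` a bounded distance leaves finitely many pairs (`four_mul_le_of_square`). -/

namespace EisensteinSpectrum

/-! ### Weighted heights, and their weak dependence on the conjugate parameter -/

/-- The weight of a fraction with numerator `p`. -/
noncomputable def weight (p : ℕ) : ℝ := if 3 ∣ p then 1 / 3 else 1

/-- The normalised value of the form `(p - x q) (p + y q)` at `v = (p, q)`. -/
noncomputable def height (x y : ℝ) (v : ℕ × ℕ) : ℝ :=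
  weight v.1 * |(v.1 : ℝ) - x * v.2| * (v.1 + y * v.2) / (x + y)

/-- The pairs of coprime positive integers at which `height x y` is at most `μ`. -/
def goodPairs (x y μ : ℝ) : Set (ℕ × ℕ) :=
  {v | 0 < v.1 ∧ 0 < v.2 ∧ Nat.Coprime v.1 v.2 ∧ height x y v ≤ μ}

lemma weight_pos (p : ℕ) : 0 < weight p := by unfold weight; split_ifs <;> norm_num

lemma weight_le_one (p : ℕ) : weight p ≤ 1 := by unfold weight; split_ifs <;> norm_num

lemma third_le_weight (p : ℕ) : 1 / 3 ≤ weight p := by unfold weight; split_ifs <;> norm_num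

lemma height_nonneg {x y : ℝ} (hx : 0 < x) (hy : 0 < y) (v : ℕ × ℕ) : 0 ≤ height x y v := by
  have := weight_pos v.1
  unfold height; positivity

lemma finite_of_add_le {T : Set (ℕ × ℕ)} (K : ℝ) (h : ∀ v ∈ T, (v.1 : ℝ) + v.2 ≤ K) :
    T.Finite := by
  obtain ⟨n, hn⟩ := exists_nat_ge K
  refine ((Set.finite_Iic n).prod (Set.finite_Iic n)).subset fun v hv => ?_
  have h1 := (h v hv).trans hn
  have h2 : v.1 + v.2 ≤ n := by exact_mod_cast h1
  exact ⟨by simp; omega, by simp; omega⟩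

lemma linear_lower (y : ℝ) (v : ℕ × ℕ) :
    min 1 y * ((v.1 : ℝ) + v.2) ≤ v.1 + y * v.2 := by
  have h1 : min 1 y ≤ 1 := min_le_left _ _
  have h2 : min 1 y ≤ y := min_le_right _ _
  have := mul_le_mul_of_nonneg_right h1 (Nat.cast_nonneg (α := ℝ) v.1)
  have := mul_le_mul_of_nonneg_right h2 (Nat.cast_nonneg (α := ℝ) v.2)
  linarith

/-- With `e = p - x q` the height equals `w |e| q + w |e| e / (x + y)`, so `y` enters only through a
term of order `e²`. -/
lemma height_sub_le {x y₁ y₂ : ℝ} (hx : 0 < x) (h₁ : 0 < y₁) (h₂ : 0 < y₂) (v : ℕ × ℕ) :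
    height x y₁ v - height x y₂ v ≤
      ((v.1 : ℝ) - x * v.2) ^ 2 * (1 / (x + y₁) + 1 / (x + y₂)) := by
  obtain ⟨e, he⟩ : ∃ e, e = (v.1 : ℝ) - x * v.2 := ⟨_, rfl⟩
  have e1 : ∀ y : ℝ, 0 < y → height x y v = weight v.1 * |e| * v.2
      + weight v.1 * (|e| * e) * (1 / (x + y)) := by
    intro y hy
    have : x + y ≠ 0 := by positivity
    have hv : (v.1 : ℝ) = e + x * v.2 := by rw [he]; ring
    unfold height
    rw [← he, hv]
    field_simp
    ring
  rw [e1 _ h₁, e1 _ h₂, ← he]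
  have i1 : 0 < 1 / (x + y₁) := by positivity
  have i2 : 0 < 1 / (x + y₂) := by positivity
  have hw0 := weight_pos v.1
  have hw1 := weight_le_one v.1
  have h0 : |weight v.1 * (|e| * e)| ≤ e ^ 2 := by
    rw [abs_mul, abs_mul, abs_abs, abs_mul_abs_self, abs_of_pos hw0]
    nlinarith [sq_nonneg e]
  obtain ⟨h5, h6⟩ := abs_le.1 h0
  generalize weight v.1 * (|e| * e) = t at *
  nlinarith [mul_le_mul_of_nonneg_right h6 i1.le, mul_le_mul_of_nonneg_right h5 i2.le]

/-- The finiteness of `goodPairs` depends on `y` only through an arbitrarily small loss. -/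
lemma goodPairs_finite_change {x y₁ y₂ μ μ' : ℝ} (hx : 0 < x) (h₁ : 0 < y₁) (h₂ : 0 < y₂)
    (hμ : μ' < μ) (hf : (goodPairs x y₁ μ).Finite) : (goodPairs x y₂ μ').Finite := by
  rcases lt_or_ge μ' 0 with h0 | h0
  · refine Set.Finite.subset Set.finite_empty fun v hv => ?_
    exact absurd hv.2.2.2 (not_le.2 (h0.trans_le (height_nonneg hx h₂ v)))
  set m := min 1 y₂ with hm
  have hmpos : 0 < m := lt_min one_pos h₂
  set K := 3 * μ' * (x + y₂) / m with hK
  have hK0 : 0 ≤ K := by positivity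
  set C := 1 / (x + y₁) + 1 / (x + y₂) with hC
  have hC0 : 0 < C := by positivity
  -- A bound `μ'` on the height gives `|e| (p + q) ≤ K`, so `e²` decays as `p + q` grows; past the
  -- stated size the change of `y` costs less than `μ - μ'`.
  have hsplit : goodPairs x y₂ μ' ⊆ goodPairs x y₁ μ ∪
      {v ∈ goodPairs x y₂ μ' | (v.1 : ℝ) + v.2 ≤ K ^ 2 * C / (μ - μ')} := by
    intro v hv
    by_cases hle : (v.1 : ℝ) + v.2 ≤ K ^ 2 * C / (μ - μ')
    · exact Or.inr ⟨hv, hle⟩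
    left
    obtain ⟨hp, hq, hc, hF⟩ := hv
    refine ⟨hp, hq, hc, ?_⟩
    push Not at hle
    have hp' : (1 : ℝ) ≤ v.1 := by exact_mod_cast hp
    have hq' : (1 : ℝ) ≤ v.2 := by exact_mod_cast hq
    set e := (v.1 : ℝ) - x * v.2 with he
    set s := (v.1 : ℝ) + v.2 with hs
    have hs1 : 1 ≤ s := by linarith
    have hw := third_le_weight v.1
    have hw1 := weight_le_one v.1
    have hlin := linear_lower y₂ v
    have hbound : |e| * s ≤ K := by
      unfold height at hF
      rw [div_le_iff₀ (by positivity)] at hF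
      rw [hK, le_div_iff₀ hmpos]
      have h1 : (1 / 3) * |e| * (m * s) ≤ weight v.1 * |e| * (v.1 + y₂ * v.2) := by
        gcongr
      have h2 : (1 / 3) * |e| * (m * s) ≤ μ' * (x + y₂) := h1.trans hF
      linarith
    have he2 : e ^ 2 ≤ K ^ 2 / s := by
      rw [le_div_iff₀ (by linarith)]
      have h3 : (|e| * s) ^ 2 ≤ K ^ 2 := by gcongr
      rw [mul_pow, sq_abs] at h3
      have h4 : e ^ 2 * s ≤ e ^ 2 * s ^ 2 := by
        gcongr
        nlinarith
      exact h4.trans h3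
    have hdiff : height x y₁ v - height x y₂ v ≤ e ^ 2 * C := height_sub_le hx h₁ h₂ v
    have : e ^ 2 * C ≤ μ - μ' := by
      have hs0 : 0 < s := by linarith
      have h7 : K ^ 2 * C / s ≤ μ - μ' := by
        rw [div_lt_iff₀ (by linarith)] at hle
        rw [div_le_iff₀ hs0]; linarith
      have h8 : e ^ 2 * C ≤ K ^ 2 / s * C := by gcongr
      have h9 : K ^ 2 / s * C = K ^ 2 * C / s := by ring
      linarith
    linarith
  refine (hf.union (finite_of_add_le (K ^ 2 * C / (μ - μ')) ?_)).subset hsplit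
  exact fun v hv => hv.2

/-! ### Möbius branches and the invariance of approximation -/

/-- An integral Möbius transformation of determinant `±1` that keeps the class of fractions
with numerator divisible by `3`. -/
structure Branch where
  a : ℕ
  b : ℕ
  c : ℕ
  d : ℕ
  a_pos : 0 < a
  d_pos : 0 < d
  det : (a : ℤ) * d - b * c = 1 ∨ (a : ℤ) * d - b * c = -1
  three_dvd : 3 ∣ b

namespace Branch

variable (g : Branch)

/-- The action on real numbers. -/
noncomputable def act (x : ℝ) : ℝ := (g.a * x + g.b) / (g.c * x + g.d)

/-- The action of the inverse on the negated conjugate point. -/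
noncomputable def dual (y : ℝ) : ℝ := (g.d * y + g.b) / (g.c * y + g.a)

/-- The action on integral vectors. -/
def mul (v : ℕ × ℕ) : ℕ × ℕ := (g.a * v.1 + g.b * v.2, g.c * v.1 + g.d * v.2)

lemma act_pos {x : ℝ} (hx : 0 < x) : 0 < g.act x := by
  have := g.a_pos
  have := g.d_pos
  unfold act; positivity

lemma dual_pos {x : ℝ} (hx : 0 < x) : 0 < g.dual x := by
  have := g.a_pos
  have := g.d_pos
  unfold dual; positivity

/-- Determinant `±1` together with `3 ∣ b` forces `3 ∤ a`. -/
lemma three_dvd_mul_iff (v : ℕ × ℕ) : 3 ∣ (g.mul v).1 ↔ 3 ∣ v.1 := by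
  obtain ⟨k, hk⟩ := g.three_dvd
  have ha : ¬ 3 ∣ g.a := by
    rintro ⟨l, hl⟩
    have := g.det
    rw [hk, hl] at this
    push_cast at this
    rcases this with h | h
    · have : (3 : ℤ) ∣ 1 := ⟨l * g.d - k * g.c, by linarith⟩
      norm_num at this
    · have : (3 : ℤ) ∣ -1 := ⟨l * g.d - k * g.c, by linarith⟩
      norm_num at this
  have : 3 ∣ (g.mul v).1 ↔ 3 ∣ g.a * v.1 := by
    unfold mul
    rw [Nat.dvd_add_left]
    exact Dvd.dvd.mul_right g.three_dvd _
  rw [this, Nat.Prime.dvd_mul Nat.prime_three]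
  tauto

lemma weight_mul (v : ℕ × ℕ) : weight (g.mul v).1 = weight v.1 := by
  unfold weight; simp [g.three_dvd_mul_iff v]

lemma mul_injective : Function.Injective g.mul := by
  rintro ⟨p, q⟩ ⟨p', q'⟩ h
  simp only [mul, Prod.mk.injEq] at h
  obtain ⟨h1, h2⟩ := h
  have e1 : (g.a : ℤ) * p + g.b * q = g.a * p' + g.b * q' := by exact_mod_cast h1
  have e2 : (g.c : ℤ) * p + g.d * q = g.c * p' + g.d * q' := by exact_mod_cast h2
  have hp : (p : ℤ) = p' := by
    rcases g.det with h | h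
    · linear_combination (g.d : ℤ) * e1 - g.b * e2 - (p - p') * h
    · linear_combination -(g.d : ℤ) * e1 + g.b * e2 + (p - p') * h
  have hq : (q : ℤ) = q' := by
    rcases g.det with h | h
    · linear_combination -(g.c : ℤ) * e1 + g.a * e2 - (q - q') * h
    · linear_combination (g.c : ℤ) * e1 - g.a * e2 + (q - q') * h
  exact Prod.ext (by exact_mod_cast hp) (by exact_mod_cast hq)

lemma coprime_mul_iff (v : ℕ × ℕ) :
    Nat.Coprime (g.mul v).1 (g.mul v).2 ↔ Nat.Coprime v.1 v.2 := by
  rw [← Nat.isCoprime_iff_coprime, ← Nat.isCoprime_iff_coprime]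
  simp only [mul]
  push_cast
  constructor
  · rintro ⟨r, s, h⟩
    exact ⟨r * g.a + s * g.c, r * g.b + s * g.d, by linear_combination h⟩
  · rintro ⟨r, s, h⟩
    rcases g.det with hd | hd
    · exact ⟨r * g.d - s * g.c, -r * g.b + s * g.a, by linear_combination h + (r * v.1 + s * v.2) * hd⟩
    · exact ⟨-r * g.d + s * g.c, r * g.b - s * g.a,
        by linear_combination h - (r * v.1 + s * v.2) * hd⟩

lemma abs_det : |(g.a : ℝ) * g.d - g.b * g.c| = 1 := by
  rcases g.det with h | h
  · have : (g.a : ℝ) * g.d - g.b * g.c = 1 := by exact_mod_cast h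
    rw [this]; simp
  · have : (g.a : ℝ) * g.d - g.b * g.c = -1 := by exact_mod_cast h
    rw [this]; simp

/-- The height is a normalised indefinite form with roots `x` and `-y`; a unimodular substitution
moves the roots, and `dual` is the resulting motion of `y`. -/
lemma height_mul {x y : ℝ} (hx : 0 < x) (hy : 0 < y) (v : ℕ × ℕ) :
    height (g.act x) y (g.mul v) = height x (g.dual y) v := by
  have ha : (0 : ℝ) < g.a := by exact_mod_cast g.a_pos
  have hd : (0 : ℝ) < g.d := by exact_mod_cast g.d_pos
  have h1 : 0 < g.c * x + g.d := by positivity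
  have h2 : 0 < g.c * y + g.a := by positivity
  have h3 : 0 < x + g.dual y := add_pos hx (g.dual_pos hy)
  have e1 : |((g.mul v).1 : ℝ) - g.act x * (g.mul v).2| = |(v.1 : ℝ) - x * v.2| / (g.c * x + g.d) := by
    have : ((g.mul v).1 : ℝ) - g.act x * (g.mul v).2 =
        ((g.a : ℝ) * g.d - g.b * g.c) * ((v.1 : ℝ) - x * v.2) / (g.c * x + g.d) := by
      simp only [mul, act]; push_cast; field_simp; ring
    rw [this, abs_div, abs_mul, abs_det, one_mul, abs_of_pos h1]
  have e2 : ((g.mul v).1 : ℝ) + y * (g.mul v).2 = (g.c * y + g.a) * (v.1 + g.dual y * v.2) := by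
    simp only [mul, dual]; push_cast; field_simp; ring
  have e3 : g.act x + y = (g.c * y + g.a) * (x + g.dual y) / (g.c * x + g.d) := by
    simp only [act, dual]; field_simp; ring
  unfold height
  rw [e1, e2, e3, weight_mul]
  field_simp

lemma mul_pos_pos {v : ℕ × ℕ} (h1 : 0 < v.1) (h2 : 0 < v.2) :
    0 < (g.mul v).1 ∧ 0 < (g.mul v).2 := by
  have := g.a_pos
  have := g.d_pos
  unfold mul; constructor <;> positivity

/-- Vectors outside the image of the positive quadrant are bad approximations. -/
lemma finite_outside {x y μ : ℝ} (hx : 0 < x) (hy : 0 < y) :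
    {v ∈ goodPairs (g.act x) y μ | ∀ u : ℕ × ℕ, 0 < u.1 → 0 < u.2 → g.mul u ≠ v}.Finite := by
  have ha : (0 : ℝ) < g.a := by exact_mod_cast g.a_pos
  have hd : (0 : ℝ) < g.d := by exact_mod_cast g.d_pos
  have h1 : 0 < g.c * x + g.d := by positivity
  have hX := g.act_pos hx
  set T : ℝ := g.a + g.b + g.c + g.d with hT
  have hT0 : 0 < T := by positivity
  set ε := min 1 x / T with hε
  have hm : 0 < min 1 x := lt_min one_pos hx
  have hm' : 0 < min 1 y := lt_min one_pos hy
  have hε0 : 0 < ε := by positivity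
  set c₀ := 1 / 3 * (ε / (g.c * x + g.d)) * min 1 y / (g.act x + y) with hc₀
  have hc₀pos : 0 < c₀ := by positivity
  refine finite_of_add_le (μ / c₀) ?_
  rintro ⟨P, Q⟩ ⟨⟨hP, hQ, -, hF⟩, hout⟩
  simp only at hP hQ
  obtain ⟨p, q, e1, e2⟩ : ∃ p q : ℤ, (g.a : ℤ) * p + g.b * q = P ∧ (g.c : ℤ) * p + g.d * q = Q := by
    rcases g.det with h | h
    · exact ⟨g.d * P - g.b * Q, -g.c * P + g.a * Q, by linear_combination P * h,
        by linear_combination Q * h⟩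
    · exact ⟨-(g.d * P - g.b * Q), -(-g.c * P + g.a * Q), by linear_combination -P * h,
        by linear_combination -Q * h⟩
  have r1 : (g.a : ℝ) * p + g.b * q = P := by exact_mod_cast e1
  have r2 : (g.c : ℝ) * p + g.d * q = Q := by exact_mod_cast e2
  -- The preimage `(p, q)` lies outside the open quadrant, so its entries cannot have the same
  -- strict sign and nothing cancels in `p - x q`. Hence this quantity is comparable to `P + Q` and
  -- the height grows quadratically.
  have habs : |(p : ℝ) - x * q| = |(p : ℝ)| + x * |(q : ℝ)| := by
    rcases le_or_gt p 0 with hp | hp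
    · rcases le_or_gt 0 q with hq | hq
      · have hp' : (p : ℝ) ≤ 0 := by exact_mod_cast hp
        have hq' : (0 : ℝ) ≤ q := by exact_mod_cast hq
        rw [abs_of_nonpos hp', abs_of_nonneg hq', abs_of_nonpos (by nlinarith)]; ring
      · exfalso
        have : (P : ℤ) ≤ 0 := by
          rw [← e1]
          have : (g.a : ℤ) * p ≤ 0 := mul_nonpos_of_nonneg_of_nonpos (by positivity) hp
          have : (g.b : ℤ) * q ≤ 0 := mul_nonpos_of_nonneg_of_nonpos (by positivity) hq.le
          linarith
        omega
    · rcases le_or_gt q 0 with hq | hq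
      · have hp' : (0 : ℝ) < p := by exact_mod_cast hp
        have hq' : (q : ℝ) ≤ 0 := by exact_mod_cast hq
        rw [abs_of_pos hp', abs_of_nonpos hq', abs_of_nonneg (by nlinarith)]; ring
      · exfalso
        refine hout (p.toNat, q.toNat) (by simpa using hp) (by simpa using hq) ?_
        have hp1 : (p.toNat : ℤ) = p := Int.toNat_of_nonneg hp.le
        have hq1 : (q.toNat : ℤ) = q := Int.toNat_of_nonneg hq.le
        simp only [mul, Prod.mk.injEq]
        constructor
        · zify; rw [hp1, hq1, e1]
        · zify; rw [hp1, hq1, e2]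
  have hlow : ε * ((P : ℝ) + Q) ≤ |(p : ℝ) - x * q| := by
    rw [habs, hε, div_mul_eq_mul_div, div_le_iff₀ hT0]
    have u1 : (P : ℝ) + Q ≤ T * (|(p : ℝ)| + |(q : ℝ)|) := by
      rw [← r1, ← r2, hT]
      have a1 := le_abs_self (p : ℝ)
      have a2 := le_abs_self (q : ℝ)
      have b1 := abs_nonneg (p : ℝ)
      have b2 := abs_nonneg (q : ℝ)
      have c1 : (0 : ℝ) ≤ g.b := by positivity
      have c2 : (0 : ℝ) ≤ g.c := by positivity
      nlinarith [mul_le_mul_of_nonneg_left a1 ha.le, mul_le_mul_of_nonneg_left a2 c1,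
        mul_le_mul_of_nonneg_left a1 c2, mul_le_mul_of_nonneg_left a2 hd.le,
        mul_nonneg ha.le b2, mul_nonneg c1 b1, mul_nonneg c2 b2, mul_nonneg hd.le b1]
    have u2 : min 1 x * (|(p : ℝ)| + |(q : ℝ)|) ≤ |(p : ℝ)| + x * |(q : ℝ)| := by
      have := mul_le_mul_of_nonneg_right (min_le_left 1 x) (abs_nonneg (p : ℝ))
      have := mul_le_mul_of_nonneg_right (min_le_right 1 x) (abs_nonneg (q : ℝ))
      linarith
    calc min 1 x * ((P : ℝ) + Q) ≤ min 1 x * (T * (|(p : ℝ)| + |(q : ℝ)|)) := by gcongr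
      _ = (min 1 x * (|(p : ℝ)| + |(q : ℝ)|)) * T := by ring
      _ ≤ _ := by gcongr
  have hval : |(P : ℝ) - g.act x * Q| = |(p : ℝ) - x * q| / (g.c * x + g.d) := by
    have : (P : ℝ) - g.act x * Q =
        ((g.a : ℝ) * g.d - g.b * g.c) * ((p : ℝ) - x * q) / (g.c * x + g.d) := by
      rw [← r1, ← r2]
      simp only [act]; field_simp; ring
    rw [this, abs_div, abs_mul, abs_det, one_mul, abs_of_pos h1]
  have hlin := linear_lower y (P, Q)
  simp only at hlin
  have hPQ : (1 : ℝ) ≤ P + Q := by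
    have : 1 ≤ P + Q := by omega
    exact_mod_cast this
  rw [le_div_iff₀ hc₀pos]
  refine le_trans ?_ hF
  unfold height
  rw [hval, hc₀, ← mul_div_assoc]
  gcongr ?_ / _
  have hw := third_le_weight P
  have key : 1 / 3 * (ε * ((P : ℝ) + Q) / (g.c * x + g.d)) * (min 1 y * (P + Q)) ≤
      weight P * (|(p : ℝ) - x * q| / (g.c * x + g.d)) * (P + y * Q) := by
    gcongr
  refine le_trans ?_ key
  have : 1 / 3 * (ε * ((P : ℝ) + Q) / (g.c * x + g.d)) * (min 1 y * (P + Q)) =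
      (1 / 3 * (ε / (g.c * x + g.d)) * min 1 y) * ((P + Q) * (P + Q)) := by ring
  rw [this, mul_comm]
  gcongr
  nlinarith

lemma goodPairs_finite_iff {x y μ : ℝ} (hx : 0 < x) (hy : 0 < y) :
    (goodPairs (g.act x) y μ).Finite ↔ (goodPairs x (g.dual y) μ).Finite := by
  constructor
  · intro h
    refine Set.Finite.of_injOn (f := g.mul) ?_ g.mul_injective.injOn h
    rintro v ⟨h1, h2, h3, h4⟩
    obtain ⟨k1, k2⟩ := g.mul_pos_pos h1 h2
    exact ⟨k1, k2, (g.coprime_mul_iff v).2 h3, by rwa [g.height_mul hx hy]⟩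
  · intro h
    refine ((h.image g.mul).union (g.finite_outside hx hy (μ := μ))).subset ?_
    rintro v hv
    by_cases hout : ∀ u : ℕ × ℕ, 0 < u.1 → 0 < u.2 → g.mul u ≠ v
    · exact Or.inr ⟨hv, hout⟩
    · push Not at hout
      obtain ⟨u, h1, h2, rfl⟩ := hout
      left
      refine ⟨u, ⟨h1, h2, (g.coprime_mul_iff u).1 hv.2.2.1, ?_⟩, rfl⟩
      rw [← g.height_mul hx hy]; exact hv.2.2.2

end Branch

/-! ### The involution `x ↦ 3 / x` -/

/-- The involution `p / q ↦ 3 q / p` on reduced fractions. -/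
def flip (v : ℕ × ℕ) : ℕ × ℕ := if 3 ∣ v.1 then (v.2, v.1 / 3) else (3 * v.2, v.1)

/-- The involution exchanges numerators divisible by `3` with those that are not; the weight `1/3`
absorbs exactly the factor `3` that appears or cancels. -/
lemma height_flip {x y : ℝ} (hx : 0 < x) (hy : 0 < y) {v : ℕ × ℕ} (hv : Nat.Coprime v.1 v.2) :
    height (3 / x) (3 / y) (flip v) = height x y v := by
  obtain ⟨p, q⟩ := v
  unfold flip
  split_ifs with h
  · obtain ⟨r, rfl⟩ : 3 ∣ p := h
    have hq : ¬ 3 ∣ q := fun h' => by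
      have := Nat.dvd_gcd (Dvd.intro r rfl : 3 ∣ 3 * r) h'
      simp only at hv
      rw [hv] at this; norm_num at this
    have h3 : 3 ∣ 3 * r := Dvd.intro r rfl
    simp only [height, weight, hq, if_false, h3, if_true]
    have e : (3 * r / 3 : ℕ) = r := by omega
    rw [e]
    have : (q : ℝ) - 3 / x * r = (-(((3 * r : ℕ) : ℝ) - x * q)) / x := by
      push_cast; field_simp; ring
    rw [this, abs_div, abs_of_pos hx, abs_neg]
    push_cast; field_simp; ring
  · simp only at h
    simp only [height, weight, h, if_false, Nat.dvd_mul_right, if_true]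
    have : ((3 * q : ℕ) : ℝ) - 3 / x * p = (-3 * ((p : ℝ) - x * q)) / x := by
      push_cast; field_simp; ring
    rw [this, abs_div, abs_of_pos hx, abs_mul]
    norm_num
    field_simp; ring

lemma flip_pos_coprime {v : ℕ × ℕ} (h1 : 0 < v.1) (h2 : 0 < v.2) (hv : Nat.Coprime v.1 v.2) :
    0 < (flip v).1 ∧ 0 < (flip v).2 ∧ Nat.Coprime (flip v).1 (flip v).2 := by
  obtain ⟨p, q⟩ := v
  simp only at h1 h2 hv
  unfold flip
  split_ifs with h
  · obtain ⟨r, rfl⟩ : 3 ∣ p := h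
    have e : (3 * r / 3 : ℕ) = r := by omega
    simp only [e]
    exact ⟨h2, by omega, (Nat.Coprime.coprime_mul_left hv).symm⟩
  · simp only at h ⊢
    refine ⟨by omega, h1, Nat.Coprime.mul_left ?_ hv.symm⟩
    exact (Nat.Prime.coprime_iff_not_dvd Nat.prime_three).2 h

lemma flip_injOn : Set.InjOn flip {v | Nat.Coprime v.1 v.2} := by
  rintro ⟨p, q⟩ h ⟨p', q'⟩ h' e
  simp only [Set.mem_ofPred_eq] at h h'
  have key : ∀ p q : ℕ, 3 ∣ p → 3 ∣ q → ¬ Nat.Coprime p q := fun p q h1 h2 h3 => by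
    have := Nat.dvd_gcd h1 h2
    rw [h3] at this; norm_num at this
  unfold flip at e
  split_ifs at e with c1 c2 c2 <;> simp only [Prod.mk.injEq] at e c1 c2 ⊢
  · omega
  · exact absurd h (key _ _ c1 ⟨q', e.1⟩)
  · exact absurd h' (key _ _ c2 ⟨q, e.1.symm⟩)
  · omega

lemma goodPairs_finite_flip {x y μ : ℝ} (hx : 0 < x) (hy : 0 < y)
    (h : (goodPairs (3 / x) (3 / y) μ).Finite) : (goodPairs x y μ).Finite := by
  refine Set.Finite.of_injOn (f := flip) ?_ (flip_injOn.mono fun v hv => hv.2.2.1) h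
  rintro v ⟨h1, h2, h3, h4⟩
  obtain ⟨k1, k2, k3⟩ := flip_pos_coprime h1 h2 h3
  exact ⟨k1, k2, k3, by rwa [height_flip hx hy h3]⟩

/-! ### Approximation constants -/

/-- The approximation constant of `x` is at least `μ`. -/
def ConstGE (x μ : ℝ) : Prop := ∀ y > 0, ∀ μ' < μ, (goodPairs x y μ').Finite

/-- The approximation constant of `x` is at most `μ`. -/
def ConstLE (x μ : ℝ) : Prop := ∀ y > 0, ∀ μ' > μ, ¬ (goodPairs x y μ').Finite

lemma ConstLE.mono {x μ ν : ℝ} (h : ConstLE x μ) (hμ : μ ≤ ν) : ConstLE x ν :=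
  fun _ hy _ hν => h _ hy _ (lt_of_le_of_lt hμ hν)

lemma ConstLE.of_infinite {x y μ : ℝ} (hx : 0 < x) (hy : 0 < y)
    (h : ¬ (goodPairs x y μ).Finite) : ConstLE x μ :=
  fun _ hy' _ hμ hf => h (goodPairs_finite_change hx hy' hy hμ hf)

lemma ConstGE.of_forall_le {x y μ : ℝ} (hx : 0 < x) (hy : 0 < y)
    (h : ∀ v : ℕ × ℕ, Nat.Coprime v.1 v.2 → μ ≤ height x y v) : ConstGE x μ := by
  intro y' hy' μ' hμ
  refine goodPairs_finite_change (μ := (μ + μ') / 2) hx hy hy' (by linarith) ?_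
  refine Set.Finite.subset Set.finite_empty fun v hv => ?_
  have := h v hv.2.2.1
  have := hv.2.2.2
  simp only [Set.mem_empty_iff_false]
  linarith

lemma ConstLE.act {x μ : ℝ} (hx : 0 < x) (g : Branch) (h : ConstLE x μ) : ConstLE (g.act x) μ :=
  fun _ hy μ' hμ hf => h _ (g.dual_pos hy) μ' hμ ((g.goodPairs_finite_iff hx hy).1 hf)

lemma ConstGE.act {x μ : ℝ} (hx : 0 < x) (g : Branch) (h : ConstGE x μ) : ConstGE (g.act x) μ :=
  fun _ hy μ' hμ => (g.goodPairs_finite_iff hx hy).2 (h _ (g.dual_pos hy) μ' hμ)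

lemma ConstLE.flip {x μ : ℝ} (hx : 0 < x) (h : ConstLE x μ) : ConstLE (3 / x) μ := by
  intro y hy μ' hμ hf
  have e : 3 / (3 / y) = y := by field_simp
  refine h (3 / y) (by positivity) μ' hμ (goodPairs_finite_flip hx (by positivity) ?_)
  rwa [e]

lemma ConstGE.flip {x μ : ℝ} (hx : 0 < x) (h : ConstGE x μ) : ConstGE (3 / x) μ := by
  intro y hy μ' hμ
  have e : 3 / (3 / x) = x := by field_simp
  refine goodPairs_finite_flip (by positivity) hy ?_
  rw [e]
  exact h (3 / y) (by positivity) μ' hμ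

/-! ### Minima of indefinite forms by reduction -/

/-- The indefinite binary quadratic form `A p² + B p q - C q²`. -/
def form (t : ℤ × ℤ × ℤ) (p q : ℤ) : ℤ := t.1 * p ^ 2 + t.2.1 * p * q - t.2.2 * q ^ 2

/-- The negative of `form t` after the substitution `(p + 3 q, p + 2 q)`. -/
def stepTwo (t : ℤ × ℤ × ℤ) : ℤ × ℤ × ℤ :=
  (t.2.2 - t.1 - t.2.1, 4 * t.2.2 - 5 * t.2.1 - 6 * t.1, 9 * t.1 + 6 * t.2.1 - 4 * t.2.2)

/-- `form t` after the substitution `(2 p + 3 q, p + 2 q)`. -/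
def stepThree (t : ℤ × ℤ × ℤ) : ℤ × ℤ × ℤ :=
  (4 * t.1 + 2 * t.2.1 - t.2.2, 12 * t.1 + 7 * t.2.1 - 4 * t.2.2,
    4 * t.2.2 - 6 * t.2.1 - 9 * t.1)

/-- The image of the quadrant under `branch₂` is the cone `q ≤ p ≤ 3q/2`. Beyond either edge, the
form is expanded along that edge and an axis; all coefficients then have one sign, the square terms
being values of the form at the old and new cone generators. -/
lemma form_outside_two {A B C N p q : ℤ} (hN : 0 < N) (hA : N ≤ A) (hC : 3 * N ≤ C)
    (hA' : N ≤ C - A - B) (hC' : 3 * N ≤ 9 * A + 6 * B - 4 * C)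
    (hp : 0 ≤ p) (hq : 0 ≤ q) (hout : p < q ∨ 3 * q < 2 * p) :
    N ≤ |form (A, B, C) p q| ∧ (3 ∣ p → 3 * N ≤ |form (A, B, C) p q|) := by
  rcases hout with h | h
  · have key : 3 * N ≤ -form (A, B, C) p q := by
      obtain ⟨s, rfl⟩ : ∃ s, q = s + p := ⟨q - p, by ring⟩
      have hs : 1 ≤ s := by linarith
      have e : -form (A, B, C) p (s + p) = (C - A - B) * p ^ 2 + (2 * C - B) * (p * s)
          + C * s ^ 2 := by simp only [form]; ring
      rw [e]
      have h1 : 0 ≤ (C - A - B) * p ^ 2 := mul_nonneg (by linarith) (sq_nonneg p)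
      have h2 : 0 ≤ (2 * C - B) * (p * s) := mul_nonneg (by linarith) (by positivity)
      have h3 : C * 1 ≤ C * s ^ 2 := mul_le_mul_of_nonneg_left (by nlinarith) (by linarith)
      linarith
    have := neg_le_abs (form (A, B, C) p q)
    exact ⟨by linarith, fun _ => by linarith⟩
  · obtain ⟨s, hs⟩ : ∃ s, s = 2 * p - 3 * q := ⟨_, rfl⟩
    have hs1 : 1 ≤ s := by linarith
    have e : 4 * form (A, B, C) p q = A * s ^ 2 + (6 * A + 2 * B) * (s * q)
        + (9 * A + 6 * B - 4 * C) * q ^ 2 := by rw [hs]; simp only [form]; ring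
    have hcross : 7 * N ≤ 6 * A + 2 * B := by linarith
    have habs := le_abs_self (form (A, B, C) p q)
    rcases hq.eq_or_lt with h0 | h0
    · have hp1 : 1 ≤ p := by linarith
      have e' : form (A, B, C) p q = A * p ^ 2 := by rw [← h0]; simp only [form]; ring
      constructor
      · have : A * 1 ≤ A * p ^ 2 := mul_le_mul_of_nonneg_left (by nlinarith) (by linarith)
        linarith
      · rintro ⟨r, rfl⟩
        have hr : 1 ≤ r := by omega
        have : A * 9 ≤ A * (3 * r) ^ 2 := mul_le_mul_of_nonneg_left (by nlinarith) (by linarith)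
        linarith
    · have h1 : A * 1 ≤ A * s ^ 2 := mul_le_mul_of_nonneg_left (by nlinarith) (by linarith)
      have h3 : (9 * A + 6 * B - 4 * C) * 1 ≤ (9 * A + 6 * B - 4 * C) * q ^ 2 :=
        mul_le_mul_of_nonneg_left (by nlinarith) (by linarith)
      constructor
      · have h2 : (6 * A + 2 * B) * 1 ≤ (6 * A + 2 * B) * (s * q) :=
          mul_le_mul_of_nonneg_left (by nlinarith) (by linarith)
        linarith
      · intro h'
        have hs3 : 3 ≤ s := by omega
        have h2 : (6 * A + 2 * B) * 3 ≤ (6 * A + 2 * B) * (s * q) :=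
          mul_le_mul_of_nonneg_left (by nlinarith) (by linarith)
        linarith

/-- The same argument for the cone `3q/2 ≤ p ≤ 2q` of `branch₃`. -/
lemma form_outside_three {A B C N p q : ℤ} (hN : 0 < N) (hA : N ≤ A) (hC : 3 * N ≤ C)
    (hA' : N ≤ 4 * A + 2 * B - C) (hC' : 3 * N ≤ 4 * C - 6 * B - 9 * A)
    (hp : 0 ≤ p) (hq : 0 ≤ q) (hout : 2 * p < 3 * q ∨ 2 * q < p) :
    N ≤ |form (A, B, C) p q| ∧ (3 ∣ p → 3 * N ≤ |form (A, B, C) p q|) := by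
  rcases hout with h | h
  · obtain ⟨s, hs⟩ : ∃ s, s = 3 * q - 2 * p := ⟨_, rfl⟩
    have hs1 : 1 ≤ s := by linarith
    have e : 9 * -form (A, B, C) p q = (4 * C - 6 * B - 9 * A) * p ^ 2
        + (4 * C - 3 * B) * (p * s) + C * s ^ 2 := by rw [hs]; simp only [form]; ring
    have hcross : 12 * N ≤ 4 * C - 3 * B := by linarith
    have habs := neg_le_abs (form (A, B, C) p q)
    by_cases hd : 3 ∣ p
    · have hs3 : 3 ≤ s := by omega
      have h1 : 0 ≤ (4 * C - 6 * B - 9 * A) * p ^ 2 := mul_nonneg (by linarith) (sq_nonneg p)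
      have h2 : 0 ≤ (4 * C - 3 * B) * (p * s) := mul_nonneg (by linarith) (by positivity)
      have h3 : C * 9 ≤ C * s ^ 2 := mul_le_mul_of_nonneg_left (by nlinarith) (by linarith)
      exact ⟨by linarith, fun _ => by linarith⟩
    · have hp1 : 1 ≤ p := by omega
      have h1 : (4 * C - 6 * B - 9 * A) * 1 ≤ (4 * C - 6 * B - 9 * A) * p ^ 2 :=
        mul_le_mul_of_nonneg_left (by nlinarith) (by linarith)
      have h2 : (4 * C - 3 * B) * 1 ≤ (4 * C - 3 * B) * (p * s) :=
        mul_le_mul_of_nonneg_left (by nlinarith) (by linarith)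
      have h3 : C * 1 ≤ C * s ^ 2 := mul_le_mul_of_nonneg_left (by nlinarith) (by linarith)
      exact ⟨by linarith, fun h' => absurd h' hd⟩
  · obtain ⟨s, rfl⟩ : ∃ s, p = s + 2 * q := ⟨p - 2 * q, by ring⟩
    have hs1 : 1 ≤ s := by linarith
    have e : form (A, B, C) (s + 2 * q) q = A * s ^ 2 + (4 * A + B) * (s * q)
        + (4 * A + 2 * B - C) * q ^ 2 := by simp only [form]; ring
    have habs := le_abs_self (form (A, B, C) (s + 2 * q) q)
    have hcross : 4 * N ≤ 2 * (4 * A + B) := by linarith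
    have h1 : A * 1 ≤ A * s ^ 2 := mul_le_mul_of_nonneg_left (by nlinarith) (by linarith)
    have h2 : 0 ≤ (4 * A + B) * (s * q) := mul_nonneg (by linarith) (by positivity)
    have h3 : 0 ≤ (4 * A + 2 * B - C) * q ^ 2 := mul_nonneg (by linarith) (sq_nonneg q)
    refine ⟨by linarith, fun hd => ?_⟩
    by_cases hs3 : 3 ≤ s
    · have : A * 9 ≤ A * s ^ 2 := mul_le_mul_of_nonneg_left (by nlinarith) (by linarith)
      linarith
    · have hq1 : 1 ≤ q := by omega
      have h2 : (4 * A + B) * 1 ≤ (4 * A + B) * (s * q) :=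
        mul_le_mul_of_nonneg_left (by nlinarith) (by linarith)
      have h3 : (4 * A + 2 * B - C) * 1 ≤ (4 * A + 2 * B - C) * q ^ 2 :=
        mul_le_mul_of_nonneg_left (by nlinarith) (by linarith)
      linarith

/-- A family of forms closed under reduction steps has the expected minimum. -/
lemma form_lower_bound {𝓕 : Set (ℤ × ℤ × ℤ)} {N : ℤ} (hN : 0 < N)
    (hb : ∀ t ∈ 𝓕, N ≤ t.1 ∧ 3 * N ≤ t.2.2) (hs : ∀ t ∈ 𝓕, stepTwo t ∈ 𝓕 ∨ stepThree t ∈ 𝓕) :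
    ∀ n : ℕ, ∀ t ∈ 𝓕, ∀ p q : ℤ, 0 ≤ p → 0 ≤ q → 0 < p + q → p + q ≤ n →
      N ≤ |form t p q| ∧ (3 ∣ p → 3 * N ≤ |form t p q|) := by
  intro n
  induction n with
  | zero => intro t _ p q _ _ h1 h2; push_cast at h2; omega
  | succ n ih =>
    rintro ⟨A, B, C⟩ ht p q hp hq h1 h2
    push_cast at h2
    obtain ⟨hA, hC⟩ := hb _ ht
    simp only at hA hC
    rcases hs _ ht with h | h
    · obtain ⟨hA', hC'⟩ := hb _ h
      by_cases hout : p < q ∨ 3 * q < 2 * p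
      · exact form_outside_two hN hA hC hA' hC' hp hq hout
      -- Inside the cone the vector is pulled back through the branch. This lowers `p + q`,
      -- preserves divisibility of the first entry by `3`, and replaces the form by its reduction
      -- step.
      · push Not at hout
        have e : form (A, B, C) p q = -form (stepTwo (A, B, C)) (3 * q - 2 * p) (p - q) := by
          simp only [form, stepTwo]; ring
        rw [e, abs_neg]
        obtain ⟨i1, i2⟩ := ih _ h (3 * q - 2 * p) (p - q) (by omega) (by omega) (by omega) (by omega)
        exact ⟨i1, fun h3 => i2 (by omega)⟩
    · obtain ⟨hA', hC'⟩ := hb _ h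
      by_cases hout : 2 * p < 3 * q ∨ 2 * q < p
      · exact form_outside_three hN hA hC hA' hC' hp hq hout
      · push Not at hout
        have e : form (A, B, C) p q = form (stepThree (A, B, C)) (2 * p - 3 * q) (2 * q - p) := by
          simp only [form, stepThree]; ring
        rw [e]
        obtain ⟨i1, i2⟩ := ih _ h (2 * p - 3 * q) (2 * q - p) (by omega) (by omega) (by omega) (by omega)
        exact ⟨i1, fun h3 => i2 (by omega)⟩

/-- The positive root of a form and the negative of its other root. -/
structure IsRootPair (t : ℤ × ℤ × ℤ) (x y : ℝ) : Prop where
  lead : 0 < t.1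
  pos : 0 < x
  conj_pos : 0 < y
  linear : (t.2.1 : ℝ) = t.1 * (y - x)
  const : (t.2.2 : ℝ) = t.1 * (x * y)

lemma IsRootPair.height_eq {t : ℤ × ℤ × ℤ} {x y : ℝ} (h : IsRootPair t x y) (v : ℕ × ℕ) :
    height x y v = weight v.1 * |(form t v.1 v.2 : ℝ)| / (t.1 * (x + y)) := by
  have hx := h.pos
  have hy := h.conj_pos
  have hA : (0 : ℝ) < t.1 := by exact_mod_cast h.lead
  have e : (form t v.1 v.2 : ℝ) = t.1 * (((v.1 : ℝ) - x * v.2) * (v.1 + y * v.2)) := by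
    simp only [form]; push_cast; rw [h.linear, h.const]; ring
  have h3 : (0 : ℝ) ≤ v.1 + y * v.2 := by positivity
  rw [e, abs_mul, abs_mul, abs_of_pos hA, abs_of_nonneg h3]
  unfold height
  field_simp

/-- The stronger bound `3 N` at numerators divisible by `3` compensates for their weight `1/3`. -/
lemma IsRootPair.constGE {t : ℤ × ℤ × ℤ} {x y : ℝ} (h : IsRootPair t x y)
    {𝓕 : Set (ℤ × ℤ × ℤ)} {N : ℤ} (hN : 0 < N)
    (hb : ∀ t ∈ 𝓕, N ≤ t.1 ∧ 3 * N ≤ t.2.2) (hs : ∀ t ∈ 𝓕, stepTwo t ∈ 𝓕 ∨ stepThree t ∈ 𝓕)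
    (ht : t ∈ 𝓕) : ConstGE x (N / (t.1 * (x + y))) := by
  have hx := h.pos
  have hy := h.conj_pos
  have hA : (0 : ℝ) < t.1 := by exact_mod_cast h.lead
  refine ConstGE.of_forall_le hx hy fun v hv => ?_
  rw [h.height_eq]
  have h0 : 0 < v.1 + v.2 := by
    by_contra h0
    have h1 : v.1 = 0 := by omega
    have h2 : v.2 = 0 := by omega
    rw [h1, h2] at hv
    norm_num at hv
  obtain ⟨i1, i2⟩ := form_lower_bound hN hb hs (v.1 + v.2) t ht v.1 v.2 (by positivity)
    (by positivity) (by exact_mod_cast h0) (by push_cast; rfl)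
  gcongr
  unfold weight
  split_ifs with h3
  · have : ((3 * N : ℤ) : ℝ) ≤ ((|form t v.1 v.2| : ℤ) : ℝ) :=
      Int.cast_le.2 (i2 (by exact_mod_cast h3))
    push_cast at this
    linarith
  · have : (N : ℝ) ≤ ((|form t v.1 v.2| : ℤ) : ℝ) := Int.cast_le.2 i1
    push_cast at this
    linarith

/-- An automorph of a form with positive entries yields infinitely many good approximations. -/
lemma IsRootPair.constLE {t : ℤ × ℤ × ℤ} {x y : ℝ} (h : IsRootPair t x y) (g : Branch)
    (hb : 0 < g.b) (hc : 0 < g.c)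
    (hg : ∀ p q : ℤ, |form t (g.a * p + g.b * q) (g.c * p + g.d * q)| = |form t p q|) :
    ConstLE x (t.2.2 / 3 / (t.1 * (x + y))) := by
  have hx := h.pos
  have hy := h.conj_pos
  have hA : (0 : ℝ) < t.1 := by exact_mod_cast h.lead
  have hC : (0 : ℝ) < t.2.2 := by rw [h.const]; positivity
  have ha := g.a_pos
  have hd := g.d_pos
  refine ConstLE.of_infinite hx hy ?_
  -- The orbit of `(0, 1)` keeps `|form|` equal to its value `C` and its numerators divisible by
  -- `3`. It begins at the first iterate because `(0, 1)` itself has a zero entry.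
  set u : ℕ → ℕ × ℕ := fun n => g.mul^[n + 1] (0, 1) with hu
  have hsucc : ∀ n, u (n + 1) = g.mul (u n) := fun n => Function.iterate_succ_apply' _ _ _
  have hzero : u 0 = g.mul (0, 1) := rfl
  have hpos : ∀ n, 0 < (u n).1 ∧ 0 < (u n).2 := by
    intro n
    induction n with
    | zero => rw [hzero]; simp only [Branch.mul]; constructor <;> positivity
    | succ n ih => rw [hsucc]; exact g.mul_pos_pos ih.1 ih.2
  have hcop : ∀ n, Nat.Coprime (u n).1 (u n).2 := by
    intro n
    induction n with
    | zero => rw [hzero, g.coprime_mul_iff]; norm_num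
    | succ n ih => rw [hsucc, g.coprime_mul_iff]; exact ih
  have hdvd : ∀ n, 3 ∣ (u n).1 := by
    intro n
    induction n with
    | zero => rw [hzero, g.three_dvd_mul_iff]; norm_num
    | succ n ih => rw [hsucc, g.three_dvd_mul_iff]; exact ih
  have hstep : ∀ v : ℕ × ℕ, |form t (g.mul v).1 (g.mul v).2| = |form t v.1 v.2| := by
    intro v
    rw [← hg v.1 v.2]
    simp only [Branch.mul]; push_cast; rfl
  have hform : ∀ n, |form t (u n).1 (u n).2| = t.2.2 := by
    have hC' : 0 < t.2.2 := by exact_mod_cast hC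
    intro n
    induction n with
    | zero =>
      rw [hzero, hstep]
      simp [form, abs_of_pos hC']
    | succ n ih => rw [hsucc, hstep, ih]
  have hmono : StrictMono fun n => (u n).1 := by
    refine strictMono_nat_of_lt_succ fun n => ?_
    rw [hsucc]
    simp only [Branch.mul]
    have h1 := Nat.le_mul_of_pos_left (u n).1 ha
    have h2 : 0 < g.b * (u n).2 := Nat.mul_pos hb (hpos n).2
    omega
  have hinj : Function.Injective u := fun m n hmn => hmono.injective (congrArg Prod.fst hmn)
  refine (Set.infinite_of_injective_forall_mem hinj fun n => ?_)
  refine ⟨(hpos n).1, (hpos n).2, hcop n, ?_⟩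
  rw [h.height_eq]
  gcongr
  have : |(form t (u n).1 (u n).2 : ℝ)| = t.2.2 := by exact_mod_cast congrArg (Int.cast (R := ℝ)) (hform n)
  rw [this, weight, if_pos (hdvd n)]
  linarith

/-! ### Constants of the extremal fixed points -/

/-- The approximation constant of `x` equals `μ`. -/
def ConstEq (x μ : ℝ) : Prop := ConstGE x μ ∧ ConstLE x μ

lemma ConstEq.act {x μ : ℝ} (hx : 0 < x) (g : Branch) (h : ConstEq x μ) : ConstEq (g.act x) μ :=
  ⟨h.1.act hx g, h.2.act hx g⟩

lemma ConstEq.flip {x μ : ℝ} (hx : 0 < x) (h : ConstEq x μ) : ConstEq (3 / x) μ :=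
  ⟨h.1.flip hx, h.2.flip hx⟩

/-- The map `x / (x + 1)` onto `(0, 1)`. -/
def branch₁ : Branch := ⟨1, 0, 1, 1, by norm_num, by norm_num, by norm_num, by norm_num⟩
/-- The map `(x + 3) / (x + 2)` onto `(1, 3 / 2)`. -/
def branch₂ : Branch := ⟨1, 3, 1, 2, by norm_num, by norm_num, by norm_num, by norm_num⟩
/-- The map `(2 x + 3) / (x + 2)` onto `(3 / 2, 2)`. -/
def branch₃ : Branch := ⟨2, 3, 1, 2, by norm_num, by norm_num, by norm_num, by norm_num⟩
/-- The map `(2 x + 3) / (x + 1)` onto `(2, 3)`. -/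
def branch₄ : Branch := ⟨2, 3, 1, 1, by norm_num, by norm_num, by norm_num, by norm_num⟩
/-- The map `x + 3` onto `(3, ∞)`. -/
def branch₅ : Branch := ⟨1, 3, 0, 1, by norm_num, by norm_num, by norm_num, by norm_num⟩

/-- The fixed point is a root of `x² + x = 3`; its form `(1, 1, 3)`, of discriminant `13`, is its
own `stepTwo`, so a single form makes a closed family. -/
lemma constEq_of_fixed_two {x : ℝ} (hx : 0 < x) (h : branch₂.act x = x) :
    ConstEq x (1 / √13) := by
  have hq : x ^ 2 + x = 3 := by
    simp only [Branch.act, branch₂] at h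
    push_cast at h
    rw [div_eq_iff (by positivity)] at h
    linarith
  have hr : IsRootPair (1, 1, 3) x (x + 1) :=
    ⟨by norm_num, hx, by linarith, by norm_num, by push_cast; linarith⟩
  have hs : ((1 : ℤ) : ℝ) * (x + (x + 1)) = √13 := by
    symm
    rw [Real.sqrt_eq_iff_mul_self_eq (by norm_num) (by push_cast; linarith)]
    push_cast; nlinarith
  constructor
  · have := hr.constGE (𝓕 := {(1, 1, 3)}) (N := 1) (by norm_num) (by simp)
      (by simp [stepTwo]) (by simp)
    rw [hs] at this
    simpa using this
  · have := hr.constLE branch₂ (by decide) (by decide) (fun p q => by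
      rw [← abs_neg]
      simp only [form, branch₂]; push_cast; ring_nf)
    rw [hs] at this
    simpa using this

/-- The coefficients `(a, b)` of the matrix `(a, 3 b; b, a + b)` of the `2 j`-th power of
`branch₂`. -/
def pell : ℕ → ℕ × ℕ
  | 0 => (1, 0)
  | j + 1 => (4 * (pell j).1 + 9 * (pell j).2, 3 * (pell j).1 + 7 * (pell j).2)

/-- This is the norm form of `ℤ[(1 + √13) / 2]`; its value is also the determinant of `word j`. -/
lemma pell_norm (j : ℕ) :
    ((pell j).1 : ℤ) ^ 2 + (pell j).1 * (pell j).2 - 3 * (pell j).2 ^ 2 = 1 := by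
  induction j with
  | zero => simp [pell]
  | succ j ih => simp only [pell]; push_cast; linear_combination ih

lemma pell_pos (j : ℕ) : 0 < (pell j).1 := by
  induction j with
  | zero => simp [pell]
  | succ j ih => simp only [pell]; omega

/-- The composition of the `2 j`-th power of `branch₂` with `branch₃`. -/
def word (j : ℕ) : Branch where
  a := 2 * (pell j).1 + 3 * (pell j).2
  b := 3 * ((pell j).1 + 2 * (pell j).2)
  c := (pell j).1 + 3 * (pell j).2
  d := 2 * (pell j).1 + 5 * (pell j).2
  a_pos := by have := pell_pos j; omega
  d_pos := by have := pell_pos j; omega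
  det := by left; push_cast; linear_combination pell_norm j
  three_dvd := Dvd.intro _ rfl

/-- The form with root the fixed point of `word j`. -/
def wordForm (j : ℕ) : ℤ × ℤ × ℤ :=
  ((pell j).1 + 3 * (pell j).2, 2 * (pell j).2, 3 * ((pell j).1 + 2 * (pell j).2))

/-- The numbers `1, 10, 109, 1189, …`. -/
def markoff (j : ℕ) : ℕ := (pell j).1 + 2 * (pell j).2

/-- With `N = a + 2b` and `M = a + 3b` the fixed-point equation is `M x² + 2b x = 3N`, and the norm
relation turns its discriminant into `4 (4N² - 1)`. -/
lemma root_of_fixed {a b x : ℝ} (ha : 0 < a) (hb : 0 ≤ b) (hx : 0 < x)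
    (hn : a ^ 2 + a * b - 3 * b ^ 2 = 1)
    (h : ((2 * a + 3 * b) * x + 3 * (a + 2 * b)) / ((a + 3 * b) * x + (2 * a + 5 * b)) = x) :
    2 * b = (a + 3 * b) * (x + 2 * b / (a + 3 * b) - x) ∧
    3 * (a + 2 * b) = (a + 3 * b) * (x * (x + 2 * b / (a + 3 * b))) ∧
    (a + 3 * b) * (x + (x + 2 * b / (a + 3 * b))) = 2 * √(4 * (a + 2 * b) ^ 2 - 1) := by
  rw [div_eq_iff (by positivity)] at h
  have hM : 0 < a + 3 * b := by positivity
  have hq : (a + 3 * b) * x ^ 2 + 2 * b * x = 3 * (a + 2 * b) := by linarith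
  refine ⟨by field_simp; ring, ?_, ?_⟩
  · rw [← hq]; field_simp
  · have hy : (a + 3 * b) * (x + (x + 2 * b / (a + 3 * b))) = 2 * ((a + 3 * b) * x + b) := by
      field_simp; ring
    have e : 4 * (a + 2 * b) ^ 2 - 1 = ((a + 3 * b) * x + b) ^ 2 := by
      linear_combination -(a + 3 * b) * hq + hn
    rw [hy, e, Real.sqrt_sq (by positivity)]

lemma isRootPair_word {j : ℕ} {x : ℝ} (hx : 0 < x) (h : (word j).act x = x) :
    IsRootPair (wordForm j) x (x + 2 * (pell j).2 / ((pell j).1 + 3 * (pell j).2)) ∧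
    ((wordForm j).1 : ℝ) * (x + (x + 2 * (pell j).2 / ((pell j).1 + 3 * (pell j).2))) =
      2 * √(4 * (markoff j : ℝ) ^ 2 - 1) := by
  have hp := pell_pos j
  have ha : (0 : ℝ) < (pell j).1 := by exact_mod_cast hp
  have hn : ((pell j).1 : ℝ) ^ 2 + (pell j).1 * (pell j).2 - 3 * (pell j).2 ^ 2 = 1 := by
    exact_mod_cast pell_norm j
  simp only [Branch.act, word] at h
  push_cast at h
  obtain ⟨h1, h2, h3⟩ := root_of_fixed ha (by positivity) hx hn h
  refine ⟨⟨?_, hx, by positivity, ?_, ?_⟩, ?_⟩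
  · simp only [wordForm]; positivity
  · simp only [wordForm]; push_cast; exact h1
  · simp only [wordForm]; push_cast; exact h2
  · simp only [wordForm, markoff]; push_cast; exact h3

/-- The approximation constant of the fixed point of `word j`. -/
noncomputable def peak (j : ℕ) : ℝ := markoff j / (2 * √(4 * (markoff j : ℝ) ^ 2 - 1))

/-- `word j` multiplies its form by the norm of `pell j`, which is `1`, so it is an automorph. A
third of the last coefficient is `markoff j`. -/
lemma constLE_of_fixed_word {j : ℕ} {x : ℝ} (hx : 0 < x)
    (h : (word j).act x = x) : ConstLE x (peak j) := by
  obtain ⟨hr, hs⟩ := isRootPair_word hx h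
  have := hr.constLE (word j) (Nat.mul_pos (by norm_num) (Nat.add_pos_left (pell_pos j) _))
    (Nat.add_pos_left (pell_pos j) _) (fun p q => by
      congr 1
      have hn := pell_norm j
      simp only [form, wordForm, word]
      push_cast
      linear_combination (((pell j).1 + 3 * (pell j).2) * p ^ 2 + 2 * (pell j).2 * p * q
        - 3 * ((pell j).1 + 2 * (pell j).2) * q ^ 2) * hn)
  rw [hs] at this
  refine this.mono (le_of_eq ?_)
  simp only [wordForm, peak, markoff]
  push_cast
  rw [mul_div_cancel_left₀ _ (by norm_num)]

/-- The family is meant to be the cycle of reductions of `wordForm j`: `2 j` times `stepTwo`, then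
`stepThree`. The instances below list these cycles. -/
lemma constEq_of_fixed_word {j : ℕ} {x : ℝ} (hx : 0 < x)
    (h : (word j).act x = x) {𝓕 : Set (ℤ × ℤ × ℤ)} (ht : wordForm j ∈ 𝓕)
    (hb : ∀ t ∈ 𝓕, (markoff j : ℤ) ≤ t.1 ∧ 3 * (markoff j : ℤ) ≤ t.2.2)
    (hs : ∀ t ∈ 𝓕, stepTwo t ∈ 𝓕 ∨ stepThree t ∈ 𝓕) : ConstEq x (peak j) := by
  refine ⟨?_, constLE_of_fixed_word hx h⟩
  obtain ⟨hr, hr'⟩ := isRootPair_word hx h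
  have hN : (0 : ℤ) < markoff j := by
    have := pell_pos j
    unfold markoff; positivity
  have := hr.constGE hN hb hs ht
  rw [hr'] at this
  exact this

lemma word_zero : word 0 = branch₃ := rfl

lemma constEq_of_fixed_word_zero {x : ℝ} (hx : 0 < x) (h : (word 0).act x = x) :
    ConstEq x (peak 0) := by
  refine constEq_of_fixed_word hx h (𝓕 := {(1, 0, 3)}) ?_ ?_ ?_ <;>
  simp [wordForm, pell, markoff, stepTwo, stepThree]

lemma constEq_of_fixed_word_one {x : ℝ} (hx : 0 < x) (h : (word 1).act x = x) :
    ConstEq x (peak 1) := by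
  refine constEq_of_fixed_word hx h
    (𝓕 := {(13, 6, 30), (11, 12, 33), (10, 6, 39)}) ?_ ?_ ?_ <;>
  simp [wordForm, pell, markoff, stepTwo, stepThree]

lemma constEq_of_fixed_word_two {x : ℝ} (hx : 0 < x) (h : (word 2).act x = x) :
    ConstEq x (peak 2) := by
  refine constEq_of_fixed_word hx h
    (𝓕 := {(142, 66, 327), (119, 126, 366), (121, 120, 363), (122, 126, 357),
      (109, 66, 426)}) ?_ ?_ ?_ <;>
  simp [wordForm, pell, markoff, stepTwo, stepThree]

lemma constEq_of_fixed_word_three {x : ℝ} (hx : 0 < x) (h : (word 3).act x = x) :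
    ConstEq x (peak 3) := by
  refine constEq_of_fixed_word hx h
    (𝓕 := {(1549, 720, 3567), (1298, 1374, 3993), (1321, 1314, 3954), (1319, 1320, 3957),
      (1318, 1314, 3963), (1331, 1374, 3894), (1189, 720, 4647)}) ?_ ?_ ?_ <;>
  simp [wordForm, pell, markoff, stepTwo, stepThree]

lemma markoff_mono : Monotone markoff := by
  refine monotone_nat_of_le_succ fun j => ?_
  simp only [markoff, pell]; omega

lemma peak_antitone {i j : ℕ} (h : i ≤ j) : peak j ≤ peak i := by
  have h1 : ∀ j, (1 : ℝ) ≤ markoff j := fun j => by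
    have := pell_pos j
    have : 1 ≤ markoff j := by unfold markoff; omega
    exact_mod_cast this
  have h2 : (markoff i : ℝ) ≤ markoff j := by exact_mod_cast markoff_mono h
  have hi := h1 i
  have hj := h1 j
  unfold peak
  rw [div_le_div_iff₀ (by have : 0 < √(4 * (markoff j : ℝ) ^ 2 - 1) := Real.sqrt_pos.2 (by nlinarith)
                          positivity)
    (by have : 0 < √(4 * (markoff i : ℝ) ^ 2 - 1) := Real.sqrt_pos.2 (by nlinarith)
        positivity)]
  have e : ∀ s t : ℝ, 0 ≤ s → s * √t = √(s ^ 2 * t) := fun s t hs => by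
    rw [Real.sqrt_mul (sq_nonneg s), Real.sqrt_sq hs]
  have h3 : (markoff j : ℝ) * √(4 * (markoff i : ℝ) ^ 2 - 1) ≤
      markoff i * √(4 * (markoff j : ℝ) ^ 2 - 1) := by
    rw [e _ _ (by linarith), e _ _ (by linarith)]
    refine Real.sqrt_le_sqrt ?_
    nlinarith
  linarith

/-- This makes `1/4` a usable cutoff: constants at most `1/4` lie below every peak. -/
lemma quarter_le_peak (j : ℕ) : 1 / 4 ≤ peak j := by
  have h1 : (1 : ℝ) ≤ markoff j := by
    have := pell_pos j
    have : 1 ≤ markoff j := by unfold markoff; omega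
    exact_mod_cast this
  have h0 : 0 < √(4 * (markoff j : ℝ) ^ 2 - 1) := Real.sqrt_pos.2 (by nlinarith)
  have h2 : √(4 * (markoff j : ℝ) ^ 2 - 1) ≤ 2 * markoff j :=
    Real.sqrt_le_iff.2 ⟨by positivity, by nlinarith⟩
  unfold peak
  rw [le_div_iff₀ (by positivity)]
  linarith

/-! ### Combinatorics of the digits of tight orbits -/

/-- Two sequences obeying the same decreasing recursion alternate in order, which restricts the
parity of the place where they separate. -/
lemma odd_of_alternating {A B : ℕ → ℝ} {a b : ℕ} (hA1 : ∀ i, 1 < A i) (hB1 : ∀ i, 1 < B i)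
    (hA : ∀ i < a, A i = 2 + 1 / (A (i + 1) + 1)) (hB : ∀ i < b, B i = 2 + 1 / (B (i + 1) + 1))
    (ha : A a < 2) (hb : 5 / 2 < B b) (h0 : B 0 < A 0) :
    (a ≤ b → Odd a) ∧ (b < a → Odd b) := by
  have key : ∀ i, i ≤ a → i ≤ b → (Even i → B i < A i) ∧ (Odd i → A i < B i) := by
    intro i
    induction i with
    | zero => exact fun _ _ => ⟨fun _ => h0, fun h => by simp at h⟩
    | succ i ih =>
      intro h1 h2
      obtain ⟨i1, i2⟩ := ih (by omega) (by omega)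
      have eA := hA i (by omega)
      have eB := hB i (by omega)
      have pA := hA1 (i + 1)
      have pB := hB1 (i + 1)
      constructor
      · intro he
        have ho : Odd i := by simpa [Nat.even_add_one] using he
        have h3 := i2 ho
        rw [eA, eB] at h3
        have h4 : 1 / (A (i + 1) + 1) < 1 / (B (i + 1) + 1) := by linarith
        rw [one_div_lt_one_div (by linarith) (by linarith)] at h4
        linarith
      · intro ho
        have he : Even i := by
          rw [← Nat.not_odd_iff_even]
          intro h; exact (Nat.not_odd_iff_even.2 h.add_one) ho
        have h3 := i1 he
        rw [eA, eB] at h3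
        have h4 : 1 / (B (i + 1) + 1) < 1 / (A (i + 1) + 1) := by linarith
        rw [one_div_lt_one_div (by linarith) (by linarith)] at h4
        linarith
  constructor
  · intro hab
    by_contra hodd
    -- At an even `a` this gives `B a < A a < 2`, whereas `B a > 2`, either by the recursion or
    -- because `a = b`.
    have h1 := (key a le_rfl hab).1 (Nat.not_odd_iff_even.1 hodd)
    rcases hab.eq_or_lt with h | h
    · rw [h] at h1 ha; linarith
    · have := hB a h
      have h2 : 0 < 1 / (B (a + 1) + 1) := by have := hB1 (a + 1); positivity
      linarith
  · intro hab
    by_contra hodd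
    -- At an even `b` this gives `5/2 < B b < A b`, whereas the recursion keeps `A b` below `5/2`.
    have h1 := (key b hab.le le_rfl).1 (Nat.not_odd_iff_even.1 hodd)
    have h2 := hA b hab
    have h3 : 1 / (A (b + 1) + 1) < 1 / 2 := by
      have := hA1 (b + 1)
      rw [one_div_lt_one_div (by linarith) (by norm_num)]; linarith
    linarith

/-- An orbit of the reduction all of whose end points stay on the good side; the digit `d n` is
the index of the branch used at time `n`. -/
structure TightOrbit (d : ℕ → ℕ) (x y : ℕ → ℝ) : Prop where
  one_lt_x : ∀ n, 1 < x n
  one_lt_y : ∀ n, 1 < y n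
  x_lt : ∀ n, x n < 3
  y_lt : ∀ n, y n < 3
  add_lt : ∀ n, x n + y n < 4
  inv_lt : ∀ n, 3 / x n + 3 / y n < 4
  step : ∀ n, (d n = 2 ∧ x n = 1 + 1 / (x (n + 1) + 2) ∧ y (n + 1) = 2 + 1 / (y n + 1)) ∨
    (d n = 3 ∧ x n = 2 - 1 / (x (n + 1) + 2) ∧ y (n + 1) = 2 - 1 / (y n + 2)) ∨
    (d n = 4 ∧ x n = 2 + 1 / (x (n + 1) + 1) ∧ y (n + 1) = 1 + 1 / (y n + 2))

namespace TightOrbit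

variable {d : ℕ → ℕ} {x y : ℕ → ℝ}

/-- The involution exchanges the branches 2 and 4, fixes 3, and swaps the inequalities `add_lt` and
`inv_lt`; it halves the case analysis. -/
lemma mirror (T : TightOrbit d x y) :
    TightOrbit (fun n => 6 - d n) (fun n => 3 / x n) (fun n => 3 / y n) := by
  have hx := T.one_lt_x
  have hy := T.one_lt_y
  have lt3 : ∀ u : ℝ, 1 < u → 3 / u < 3 := fun u hu => by
    rw [div_lt_iff₀ (by linarith)]; linarith
  have gt1 : ∀ u : ℝ, 1 < u → u < 3 → 1 < 3 / u := fun u hu hu' => by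
    rw [lt_div_iff₀ (by linarith)]; linarith
  have e : ∀ u : ℝ, 1 < u → 3 / (3 / u) = u := fun u hu => by field_simp
  have m2 : ∀ u : ℝ, 1 < u → 3 / (1 + 1 / (u + 2)) = 2 + 1 / (3 / u + 1) := fun u hu => by
    field_simp; ring
  have m3 : ∀ u : ℝ, 1 < u → 3 / (2 - 1 / (u + 2)) = 2 - 1 / (3 / u + 2) := fun u hu => by
    have h1 : 2 * (u + 2) - 1 ≠ 0 := by linarith
    have h2 : 3 + 2 * u ≠ 0 := by linarith
    have h3 : 2 - 1 / (u + 2) = (2 * u + 3) / (u + 2) := by field_simp; ring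
    have h4 : 2 * u + 3 ≠ 0 := by linarith
    rw [h3]
    field_simp; ring
  have m4 : ∀ u : ℝ, 1 < u → 3 / (2 + 1 / (u + 1)) = 1 + 1 / (3 / u + 2) := fun u hu => by
    field_simp; ring
  refine ⟨fun n => gt1 _ (hx n) (T.x_lt n), fun n => gt1 _ (hy n) (T.y_lt n),
    fun n => lt3 _ (hx n), fun n => lt3 _ (hy n), T.inv_lt, fun n => ?_, fun n => ?_⟩
  · simp only [e _ (hx n), e _ (hy n)]; exact T.add_lt n
  · rcases T.step n with ⟨h1, h2, h3⟩ | ⟨h1, h2, h3⟩ | ⟨h1, h2, h3⟩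
    · right; right
      simp only [h1, h2, h3]
      exact ⟨trivial, m2 _ (hx _), m4 _ (hy _)⟩
    · right; left
      simp only [h1, h2, h3]
      exact ⟨trivial, m3 _ (hx _), m3 _ (hy _)⟩
    · left
      simp only [h1, h2, h3]
      exact ⟨trivial, m4 _ (hx _), m2 _ (hy _)⟩

lemma step_two (T : TightOrbit d x y) {n : ℕ} (h : d n = 2) :
    x n = 1 + 1 / (x (n + 1) + 2) ∧ y (n + 1) = 2 + 1 / (y n + 1) := by
  rcases T.step n with ⟨h1, h2⟩ | ⟨h1, h2⟩ | ⟨h1, h2⟩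
  · exact h2
  all_goals omega

lemma step_three (T : TightOrbit d x y) {n : ℕ} (h : d n = 3) :
    x n = 2 - 1 / (x (n + 1) + 2) ∧ y (n + 1) = 2 - 1 / (y n + 2) := by
  rcases T.step n with ⟨h1, h2⟩ | ⟨h1, h2⟩ | ⟨h1, h2⟩
  · omega
  · exact h2
  · omega

lemma step_four (T : TightOrbit d x y) {n : ℕ} (h : d n = 4) :
    x n = 2 + 1 / (x (n + 1) + 1) ∧ y (n + 1) = 1 + 1 / (y n + 2) := by
  rcases T.step n with ⟨h1, h2⟩ | ⟨h1, h2⟩ | ⟨h1, h2⟩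
  · omega
  · omega
  · exact h2

lemma one_div_bounds {u c : ℝ} (hu : 1 < u) (hc : 0 < c) :
    0 < 1 / (u + c) ∧ 1 / (u + c) < 1 / (1 + c) :=
  ⟨by positivity, by rw [one_div_lt_one_div (by linarith) (by linarith)]; linarith⟩

lemma x_bounds_three (T : TightOrbit d x y) {n : ℕ} (h : d n = 3) : 3 / 2 < x n ∧ x n < 2 := by
  have e := (T.step_three h).1
  obtain ⟨h1, h2⟩ := one_div_bounds (T.one_lt_x (n + 1)) (c := 2) (by norm_num)
  constructor <;> linarith

lemma y_bounds_three (T : TightOrbit d x y) {n : ℕ} (h : d n = 3) :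
    3 / 2 < y (n + 1) ∧ y (n + 1) < 2 := by
  have e := (T.step_three h).2
  obtain ⟨h1, h2⟩ := one_div_bounds (T.one_lt_y n) (c := 2) (by norm_num)
  constructor <;> linarith

lemma y_bounds_two (T : TightOrbit d x y) {n : ℕ} (h : d n = 2) :
    2 < y (n + 1) ∧ y (n + 1) < 5 / 2 := by
  have e := (T.step_two h).2
  obtain ⟨h1, h2⟩ := one_div_bounds (T.one_lt_y n) (c := 1) (by norm_num)
  constructor <;> linarith

lemma y_lt_two (T : TightOrbit d x y) {n : ℕ} (h : d n ≠ 2) : y (n + 1) < 2 := by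
  rcases T.step n with ⟨h1, -, -⟩ | ⟨h1, -, -⟩ | ⟨h1, -, h2⟩
  · exact absurd h1 h
  · exact (T.y_bounds_three h1).2
  · obtain ⟨h3, h4⟩ := one_div_bounds (T.one_lt_y n) (c := 2) (by norm_num)
    linarith

lemma two_lt_x (T : TightOrbit d x y) {n : ℕ} (h : d n = 4) : 2 < x n := by
  obtain ⟨h3, h4⟩ := one_div_bounds (T.one_lt_x (n + 1)) (c := 1) (by norm_num)
  have := (T.step_four h).1
  linarith

/-- This is `x + y < 4` at the boundary between the two digits, where the integer parts already add
up to `4` and the fractional tails must be compared. -/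
lemma two_three (T : TightOrbit d x y) {n : ℕ} (h : d n = 2) (h' : d (n + 1) = 3) :
    x (n + 2) + 1 < y n := by
  have e1 := (T.step_two h).2
  have e2 := (T.step_three h').1
  have := T.add_lt (n + 1)
  have hx := T.one_lt_x (n + 1 + 1)
  have hy := T.one_lt_y n
  have h4 : 1 / (y n + 1) < 1 / (x (n + 1 + 1) + 2) := by linarith
  rw [one_div_lt_one_div (by linarith) (by linarith)] at h4
  have : x (n + 2) = x (n + 1 + 1) := rfl
  linarith

lemma three_four (T : TightOrbit d x y) {n : ℕ} (h : d n = 3) (h' : d (n + 1) = 4) :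
    y n + 1 < x (n + 2) := by
  have e1 := (T.step_three h).2
  have e2 := (T.step_four h').1
  have := T.add_lt (n + 1)
  have hx := T.one_lt_x (n + 1 + 1)
  have hy := T.one_lt_y n
  have h4 : 1 / (x (n + 1 + 1) + 1) < 1 / (y n + 2) := by linarith
  rw [one_div_lt_one_div (by linarith) (by linarith)] at h4
  have : x (n + 2) = x (n + 1 + 1) := rfl
  linarith

lemma three_two (T : TightOrbit d x y) {n : ℕ} (h : d n = 3) (h' : d (n + 1) = 2) :
    3 / y n + 1 < 3 / x (n + 2) :=
  T.mirror.three_four (by simp [h]) (by simp [h'])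

lemma not_two_four (T : TightOrbit d x y) {n : ℕ} (h : d n = 2) : d (n + 1) ≠ 4 := by
  intro h'
  have := (T.y_bounds_two h).1
  have := T.two_lt_x h'
  have := T.add_lt (n + 1)
  linarith

lemma digit_cases (T : TightOrbit d x y) (n : ℕ) : d n = 2 ∨ d n = 3 ∨ d n = 4 := by
  rcases T.step n with ⟨h, -⟩ | ⟨h, -⟩ | ⟨h, -⟩ <;> omega

/-- From `two_three`, `y n > 2`, so the digit before is also 2. Then `y n < 5/2`, which pushes `x (n
+ 2)` below `3/2`. The predecessor is why `1 ≤ n` is needed. -/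
lemma two_three_two (T : TightOrbit d x y) {n : ℕ} (hn : 1 ≤ n) (h : d n = 2)
    (h' : d (n + 1) = 3) : d (n + 2) = 2 := by
  have hlt := T.two_three h h'
  obtain ⟨m, rfl⟩ : ∃ m, n = m + 1 := ⟨n - 1, by omega⟩
  have h1 := T.one_lt_x (m + 1 + 2)
  have h2 : d m = 2 := by
    by_contra h2
    have := T.y_lt_two h2
    linarith
  have h3 := (T.y_bounds_two h2).2
  rcases T.digit_cases (m + 1 + 2) with h4 | h4 | h4
  · exact h4
  · have := (T.x_bounds_three h4).1; linarith
  · have := T.two_lt_x h4; linarith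

/-- Two consecutive runs of the digit `2` between digits `3` have the same even length. -/
lemma run_eq (T : TightOrbit d x y) {i k k' : ℕ} (h0 : d i = 3)
    (hk : ∀ j < k, d (i + 1 + j) = 2) (h1 : d (i + k + 1) = 3)
    (hk' : ∀ j < k', d (i + k + 2 + j) = 2) (h2 : d (i + k + 2 + k') = 3)
    (hk1 : 1 ≤ k) (hk1' : 1 ≤ k') : k = k' ∧ Even k := by
  have hx := T.one_lt_x
  have hy := T.one_lt_y
  have hx' := T.mirror.one_lt_x
  have hy' := T.mirror.one_lt_y
  have hyi := T.y_bounds_three h0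
  have hxe := T.x_bounds_three h2
  -- Reading backwards from the middle 3, `y` runs through the first block of 2s; reading forwards,
  -- `x + 1` runs through the second. Both follow `u = 2 + 1 / (u' + 1)`, and `two_three` gives the
  -- initial order.
  have p1 := odd_of_alternating (A := fun j => y (i + k - j)) (B := fun j => x (i + k + 2 + j) + 1)
    (a := k - 1) (b := k') (fun _ => hy _) (fun j => by have := hx (i + k + 2 + j); linarith)
    (fun j hj => by
      have hd := hk (k - j - 2) (by omega)
      have := (T.step_two hd).2
      have e1 : i + 1 + (k - j - 2) + 1 = i + k - j := by omega
      have e2 : i + 1 + (k - j - 2) = i + k - (j + 1) := by omega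
      rw [e1, e2] at this
      exact this)
    (fun j hj => by
      have := (T.step_two (hk' j hj)).1
      have e1 : i + k + 2 + (j + 1) = i + k + 2 + j + 1 := by omega
      simp only [e1]
      rw [this]
      ring)
    (by
      have e1 : i + k - (k - 1) = i + 1 := by omega
      simp only [e1]; exact hyi.2)
    (by linarith)
    (by
      have hd : d (i + k) = 2 := by
        have := hk (k - 1) (by omega)
        rwa [show i + 1 + (k - 1) = i + k by omega] at this
      exact T.two_three hd h1)
  -- The mirrored comparison starts from `three_two`, with the roles of the two blocks exchanged.
  have p2 := odd_of_alternating (A := fun j => 3 / x (i + k + 3 + j))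
    (B := fun j => 3 / y (i + k + 1 - j) + 1)
    (a := k' - 1) (b := k) (fun _ => hx' _) (fun j => by have := hy' (i + k + 1 - j); linarith)
    (fun j hj => by
      have hd := hk' (j + 1) (by omega)
      have := (T.mirror.step_four (n := i + k + 2 + (j + 1)) (by simp only [hd])).1
      have e1 : i + k + 2 + (j + 1) = i + k + 3 + j := by omega
      rw [e1] at this
      exact this)
    (fun j hj => by
      have hd := hk (k - j - 1) (by omega)
      have := (T.mirror.step_four (n := i + 1 + (k - j - 1)) (by simp only [hd])).2
      have e1 : i + 1 + (k - j - 1) + 1 = i + k + 1 - j := by omega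
      have e2 : i + 1 + (k - j - 1) = i + k + 1 - (j + 1) := by omega
      rw [e1, e2] at this
      rw [this]
      ring)
    (by
      have e1 : i + k + 3 + (k' - 1) = i + k + 2 + k' := by omega
      simp only [e1]
      rw [div_lt_iff₀ (by linarith)]; linarith)
    (by
      have e1 : i + k + 1 - k = i + 1 := by omega
      simp only [e1]
      have : 3 / 2 < 3 / y (i + 1) := by
        rw [lt_div_iff₀ (by linarith)]; linarith
      linarith)
    (by
      have hd : d (i + k + 1 + 1) = 2 := hk' 0 (by omega)
      exact T.three_two h1 hd)
  -- If `k' < k - 1`, the first comparison makes `k'` odd and the second makes it even; the case `k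
  -- < k' - 1` is symmetric. So both lengths are even and differ by at most one.
  rw [Nat.odd_iff, Nat.odd_iff] at p1 p2
  rw [Nat.even_iff]
  omega

end TightOrbit

/-! ### Contraction, and the periodic tails of tight orbits -/

/-- A bounded backward orbit of a contraction is constant: `|u 0 - u 1|` is at most `4⁻ⁿ |u n - u (n
+ 1)|` for every `n`. -/
lemma fixed_of_contraction {H : ℝ → ℝ}
    (hH : ∀ u v, 1 < u → 1 < v → |H u - H v| ≤ |u - v| / 4) {u : ℕ → ℝ}
    (h1 : ∀ n, 1 < u n) (h3 : ∀ n, u n < 3) (hu : ∀ n, u n = H (u (n + 1))) : H (u 0) = u 0 := by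
  have key : ∀ n, |u 0 - u 1| ≤ |u n - u (n + 1)| * (1 / 4) ^ n := by
    intro n
    induction n with
    | zero => simp
    | succ n ih =>
      have := hH (u (n + 1)) (u (n + 1 + 1)) (h1 _) (h1 _)
      rw [← hu, ← hu] at this
      calc |u 0 - u 1| ≤ |u n - u (n + 1)| * (1 / 4) ^ n := ih
        _ ≤ (|u (n + 1) - u (n + 1 + 1)| / 4) * (1 / 4) ^ n := by gcongr
        _ = _ := by ring
  have hle : ∀ n, |u 0 - u 1| ≤ 2 * (1 / 4 : ℝ) ^ n := fun n => by
    refine (key n).trans ?_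
    gcongr
    have a1 := h1 n
    have a2 := h1 (n + 1)
    have a3 := h3 n
    have a4 := h3 (n + 1)
    rw [abs_le]; constructor <;> linarith
  have hlim : Tendsto (fun n : ℕ => 2 * (1 / 4 : ℝ) ^ n) atTop (nhds (2 * 0)) :=
    (tendsto_pow_atTop_nhds_zero_of_lt_one (by norm_num) (by norm_num)).const_mul 2
  have h0 : |u 0 - u 1| ≤ 2 * 0 := ge_of_tendsto' hlim hle
  have h01 : u 0 = u 1 := by
    have : |u 0 - u 1| = 0 := le_antisymm (by linarith) (abs_nonneg _)
    linarith [abs_eq_zero.1 this]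
  conv_rhs => rw [hu 0]
  rw [← h01]

lemma branch₂_act {u : ℝ} (hu : 0 < u) : branch₂.act u = 1 + 1 / (u + 2) := by
  simp only [Branch.act, branch₂]; push_cast; field_simp; ring

lemma branch₃_act {u : ℝ} (hu : 0 < u) : branch₃.act u = 2 - 1 / (u + 2) := by
  simp only [Branch.act, branch₃]; push_cast; field_simp; ring

lemma branch₄_act {u : ℝ} (hu : 0 < u) : branch₄.act u = 2 + 1 / (u + 1) := by
  simp only [Branch.act, branch₄]; push_cast; field_simp; ring

lemma one_div_sub_contract {u v : ℝ} (hu : 1 < u) (hv : 1 < v) :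
    |1 / (u + 2) - 1 / (v + 2)| ≤ |u - v| / 4 := by
  have : 1 / (u + 2) - 1 / (v + 2) = (v - u) / ((u + 2) * (v + 2)) := by field_simp; ring
  rw [this, abs_div, abs_sub_comm, abs_of_pos (show 0 < (u + 2) * (v + 2) by positivity)]
  gcongr
  nlinarith

lemma branch₂_contract {u v : ℝ} (hu : 1 < u) (hv : 1 < v) :
    |branch₂.act u - branch₂.act v| ≤ |u - v| / 4 := by
  rw [branch₂_act (by linarith), branch₂_act (by linarith), add_sub_add_left_eq_sub]
  exact one_div_sub_contract hu hv

lemma branch₃_contract {u v : ℝ} (hu : 1 < u) (hv : 1 < v) :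
    |branch₃.act u - branch₃.act v| ≤ |u - v| / 4 := by
  rw [branch₃_act (by linarith), branch₃_act (by linarith), sub_sub_sub_cancel_left, abs_sub_comm]
  exact one_div_sub_contract hu hv

lemma word_act (j : ℕ) {u : ℝ} (hu : 0 < u) :
    (word j).act u = branch₂.act^[2 * j] (branch₃.act u) := by
  induction j with
  | zero => rfl
  | succ j ih =>
    have e : 2 * (j + 1) = 2 * j + 1 + 1 := by ring
    rw [e, Function.iterate_succ_apply', Function.iterate_succ_apply', ← ih]
    have ha : (0 : ℝ) < (pell j).1 := by exact_mod_cast pell_pos j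
    have hb : (0 : ℝ) ≤ (pell j).2 := by positivity
    simp only [Branch.act, word, branch₂, pell]
    push_cast
    generalize ((pell j).1 : ℝ) = a at *
    generalize ((pell j).2 : ℝ) = b at *
    have hQ : 0 < (a + 3 * b) * u + (2 * a + 5 * b) := by positivity
    have hP : 0 < (2 * a + 3 * b) * u + 3 * (a + 2 * b) := by positivity
    generalize hPe : (2 * a + 3 * b) * u + 3 * (a + 2 * b) = P at *
    generalize hQe : (a + 3 * b) * u + (2 * a + 5 * b) = Q at *
    have e3 : (2 * (4 * a + 9 * b) + 3 * (3 * a + 7 * b)) * u + 3 * (4 * a + 9 * b + 2 * (3 * a + 7 * b))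
        = 4 * P + 9 * Q := by rw [← hPe, ← hQe]; ring
    have e4 : (4 * a + 9 * b + 3 * (3 * a + 7 * b)) * u + (2 * (4 * a + 9 * b) + 5 * (3 * a + 7 * b))
        = 3 * P + 7 * Q := by rw [← hPe, ← hQe]; ring
    rw [e3, e4]
    field_simp
    ring

lemma one_lt_branch₂_iterate (k : ℕ) {u : ℝ} (hu : 1 < u) : 1 < branch₂.act^[k] u := by
  induction k with
  | zero => exact hu
  | succ k ih =>
    rw [Function.iterate_succ_apply', branch₂_act (by linarith)]
    have : 0 < 1 / (branch₂.act^[k] u + 2) := by positivity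
    linarith

lemma branch₂_iterate_le (k : ℕ) {u v : ℝ} (hu : 1 < u) (hv : 1 < v) :
    |branch₂.act^[k] u - branch₂.act^[k] v| ≤ |u - v| := by
  induction k with
  | zero => exact le_rfl
  | succ k ih =>
    rw [Function.iterate_succ_apply', Function.iterate_succ_apply']
    have := branch₂_contract (one_lt_branch₂_iterate k hu) (one_lt_branch₂_iterate k hv)
    linarith [abs_nonneg (branch₂.act^[k] u - branch₂.act^[k] v)]

lemma word_contract (j : ℕ) {u v : ℝ} (hu : 1 < u) (hv : 1 < v) :
    |(word j).act u - (word j).act v| ≤ |u - v| / 4 := by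
  have h3 : ∀ w : ℝ, 1 < w → 1 < branch₃.act w := fun w hw => by
    rw [branch₃_act (by linarith)]
    have := (TightOrbit.one_div_bounds hw (c := 2) (by norm_num)).2
    linarith
  rw [word_act j (by linarith), word_act j (by linarith)]
  exact (branch₂_iterate_le _ (h3 _ hu) (h3 _ hv)).trans (branch₃_contract hu hv)

/-- The fixed points that occur as tails of tight orbits. -/
def IsSpecial (u : ℝ) : Prop := branch₂.act u = u ∨ ∃ j, (word j).act u = u

namespace TightOrbit

variable {d : ℕ → ℕ} {x y : ℕ → ℝ}

lemma act_two (T : TightOrbit d x y) {n : ℕ} (h : d n = 2) : x n = branch₂.act (x (n + 1)) := by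
  have := T.one_lt_x (n + 1)
  rw [branch₂_act (by linarith)]; exact (T.step_two h).1

lemma act_three (T : TightOrbit d x y) {n : ℕ} (h : d n = 3) : x n = branch₃.act (x (n + 1)) := by
  have := T.one_lt_x (n + 1)
  rw [branch₃_act (by linarith)]; exact (T.step_three h).1

lemma act_run (T : TightOrbit d x y) {s : ℕ} (k : ℕ) (h : ∀ j < k, d (s + j) = 2) :
    x s = branch₂.act^[k] (x (s + k)) := by
  induction k with
  | zero => rfl
  | succ k ih =>
    rw [Function.iterate_succ_apply, ih fun j hj => h j (by omega), T.act_two (h k (by omega))]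
    rfl

/-- After such a 2 only 2s and isolated 3s occur. Either the 3s stop, and the tail is fixed by
`branch₂`, or all complete runs of 2 share one even length and the tail is periodic. -/
lemma exists_special_of_two (T : TightOrbit d x y) {m : ℕ} (hm : 1 ≤ m) (hd : d m = 2) :
    ∃ n, IsSpecial (x n) := by
  have hdig : ∀ n, m ≤ n → d n = 2 ∨ (d n = 3 ∧ m + 1 ≤ n ∧ d (n - 1) = 2) := by
    intro n hn
    induction n, hn using Nat.le_induction with
    | base => exact Or.inl hd
    | succ n hn ih =>
      rcases ih with h | ⟨h, h1, h2⟩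
      · rcases T.digit_cases (n + 1) with h' | h' | h'
        · exact Or.inl h'
        · exact Or.inr ⟨h', by omega, h⟩
        · exact absurd h' (T.not_two_four h)
      · left
        have := T.two_three_two (n := n - 1) (by omega) h2
        rw [show n - 1 + 1 = n by omega, show n - 1 + 2 = n + 1 by omega] at this
        exact this h
  by_cases hall : ∃ M, m ≤ M ∧ ∀ n, M ≤ n → d n = 2
  · obtain ⟨M, -, hM⟩ := hall
    refine ⟨M, Or.inl ?_⟩
    exact fixed_of_contraction (fun u v => branch₂_contract) (u := fun n => x (M + n))
      (fun _ => T.one_lt_x _) (fun _ => T.x_lt _) (fun n => T.act_two (hM _ (by omega)))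
  push Not at hall
  have hinf : ∀ M, m ≤ M → ∃ n, M ≤ n ∧ d n = 3 := fun M hM => by
    obtain ⟨n, h1, h2⟩ := hall M hM
    exact ⟨n, h1, ((hdig n (by omega)).resolve_left h2).1⟩
  have hnext : ∀ i, m ≤ i → d i = 3 → ∃ k, 1 ≤ k ∧ (∀ j < k, d (i + 1 + j) = 2) ∧
      d (i + 1 + k) = 3 := by
    intro i hi hdi
    have hex : ∃ k, d (i + 1 + k) = 3 := by
      obtain ⟨n, h1, h2⟩ := hinf (i + 1) (by omega)
      exact ⟨n - (i + 1), by rwa [show i + 1 + (n - (i + 1)) = n by omega]⟩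
    classical
    refine ⟨Nat.find hex, ?_, fun j hj => ?_, Nat.find_spec hex⟩
    · rw [Nat.one_le_iff_ne_zero]
      intro h0
      have h1 := Nat.find_spec hex
      rw [h0] at h1
      rcases hdig (i + 1) (by omega) with h2 | ⟨-, -, h2⟩
      · simp only [add_zero] at h1; omega
      · simp only [Nat.add_sub_cancel] at h2; omega
    · have := Nat.find_min hex hj
      exact (hdig (i + 1 + j) (by omega)).resolve_right fun h => this h.1
  obtain ⟨i, hi, hdi⟩ := hinf m le_rfl
  obtain ⟨k, hk1, hk, hke⟩ := hnext i hi hdi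
  -- `run_eq` transfers the length `k` from each run to the next, so the digits repeat with period
  -- `k + 1`.
  have hper : ∀ t, d (i + t * (k + 1)) = 3 ∧ (∀ j < k, d (i + t * (k + 1) + 1 + j) = 2) ∧
      d (i + t * (k + 1) + 1 + k) = 3 ∧ Even k := by
    have hrun : ∀ i', m ≤ i' → d i' = 3 → (∀ j < k, d (i' + 1 + j) = 2) → d (i' + 1 + k) = 3 →
        (∀ j < k, d (i' + k + 2 + j) = 2) ∧ d (i' + k + 2 + k) = 3 ∧ Even k := by
      intro i' hi' h1 h2 h3
      have h3' : d (i' + k + 1) = 3 := by rwa [show i' + k + 1 = i' + 1 + k by omega]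
      obtain ⟨k', hk1', hk', hke'⟩ := hnext (i' + k + 1) (by omega) h3'
      obtain ⟨rfl, he⟩ := T.run_eq h1 h2 h3' hk' hke' hk1 hk1'
      exact ⟨hk', hke', he⟩
    intro t
    induction t with
    | zero =>
      simp only [zero_mul, add_zero]
      exact ⟨hdi, hk, hke, (hrun i hi hdi hk hke).2.2⟩
    | succ t ih =>
      obtain ⟨h1, h2, h3, -⟩ := ih
      obtain ⟨r1, r2, r3⟩ := hrun (i + t * (k + 1)) (by omega) h1 h2 h3
      have e : i + (t + 1) * (k + 1) = i + t * (k + 1) + 1 + k := by ring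
      rw [e]
      refine ⟨h3, fun j hj => ?_, ?_, r3⟩
      · have := r1 j hj
        rwa [show i + t * (k + 1) + 1 + k + 1 + j = i + t * (k + 1) + k + 2 + j by omega]
      · rwa [show i + t * (k + 1) + 1 + k + 1 + k = i + t * (k + 1) + k + 2 + k by omega]
  obtain ⟨l, hl⟩ := (hper 0).2.2.2
  have hl' : k = 2 * l := by omega
  refine ⟨i + 0 * (k + 1) + 1, Or.inr ⟨l, ?_⟩⟩
  refine fixed_of_contraction (fun u v => word_contract l)
    (u := fun t => x (i + t * (k + 1) + 1))
    (fun _ => T.one_lt_x _) (fun _ => T.x_lt _) (fun t => ?_)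
  obtain ⟨-, h2, h3, -⟩ := hper t
  have hpos := T.one_lt_x (i + (t + 1) * (k + 1) + 1)
  rw [word_act l (by linarith), ← hl', T.act_run k h2, T.act_three h3]
  rw [show i + t * (k + 1) + 1 + k + 1 = i + (t + 1) * (k + 1) + 1 by ring]

/-- A digit 4 becomes a 2 in the mirrored orbit; with neither digit after time 0, all later digits
are 3. -/
lemma exists_special (T : TightOrbit d x y) : ∃ n, IsSpecial (x n) ∨ IsSpecial (3 / x n) := by
  by_cases h2 : ∃ m, 1 ≤ m ∧ d m = 2
  · obtain ⟨m, hm, hd⟩ := h2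
    obtain ⟨n, hn⟩ := T.exists_special_of_two hm hd
    exact ⟨n, Or.inl hn⟩
  by_cases h4 : ∃ m, 1 ≤ m ∧ d m = 4
  · obtain ⟨m, hm, hd⟩ := h4
    obtain ⟨n, hn⟩ := T.mirror.exists_special_of_two hm (by simp [hd])
    exact ⟨n, Or.inr hn⟩
  push Not at h2 h4
  refine ⟨1, Or.inl (Or.inr ⟨0, ?_⟩)⟩
  refine fixed_of_contraction (fun u v => word_contract 0) (u := fun t => x (1 + t))
    (fun _ => T.one_lt_x _) (fun _ => T.x_lt _) (fun t => ?_)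
  rw [word_zero]
  refine T.act_three ?_
  rcases T.digit_cases (1 + t) with h | h | h
  · exact absurd h (h2 _ (by omega))
  · exact h
  · exact absurd h (h4 _ (by omega))

end TightOrbit

/-! ### The reduction algorithm and its nested cones -/

/-- The branch with a given index. -/
def digitBranch : ℕ → Branch
  | 1 => branch₁
  | 2 => branch₂
  | 3 => branch₃
  | 4 => branch₄
  | _ => branch₅

lemma Branch.irrational_of_act (g : Branch) {x : ℝ} (h : Irrational (g.act x)) : Irrational x := by
  rintro ⟨q, rfl⟩
  refine h ⟨(g.a * q + g.b) / (g.c * q + g.d), ?_⟩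
  simp only [Branch.act]; push_cast; rfl

/-- The images of the branches cover the positive axis except for the rational points `1, 3/2, 2,
3`. -/
lemma exists_digit {x : ℝ} (hx : 0 < x) (hi : Irrational x) :
    ∃ k x', (1 ≤ k ∧ k ≤ 5) ∧ 0 < x' ∧ Irrational x' ∧ x = (digitBranch k).act x' := by
  suffices h : ∃ k x', (1 ≤ k ∧ k ≤ 5) ∧ 0 < x' ∧ x = (digitBranch k).act x' by
    obtain ⟨k, x', h1, h2, h3⟩ := h
    exact ⟨k, x', h1, h2, (digitBranch k).irrational_of_act (h3 ▸ hi), h3⟩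
  have hne : ∀ q : ℚ, x ≠ q := fun q h => hi ⟨q, h.symm⟩
  have n1 : x ≠ 1 := by exact_mod_cast hne 1
  have n2 : x ≠ 3 / 2 := by have := hne (3 / 2); push_cast at this; exact this
  have n3 : x ≠ 2 := by exact_mod_cast hne 2
  have n4 : x ≠ 3 := by exact_mod_cast hne 3
  rcases n1.lt_or_gt with h | h1
  · refine ⟨1, x / (1 - x), by norm_num, div_pos hx (by linarith), ?_⟩
    have : 1 - x ≠ 0 := by linarith
    simp only [digitBranch, Branch.act, branch₁]; push_cast; field_simp; ring
  rcases n2.lt_or_gt with h | h2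
  · refine ⟨2, (3 - 2 * x) / (x - 1), by norm_num, div_pos (by linarith) (by linarith), ?_⟩
    have : x - 1 ≠ 0 := by linarith
    simp only [digitBranch, Branch.act, branch₂]; push_cast; field_simp; ring
  rcases n3.lt_or_gt with h | h3
  · refine ⟨3, (2 * x - 3) / (2 - x), by norm_num, div_pos (by linarith) (by linarith), ?_⟩
    have : 2 - x ≠ 0 := by linarith
    simp only [digitBranch, Branch.act, branch₃]; push_cast; field_simp; ring
  rcases n4.lt_or_gt with h | h4
  · refine ⟨4, (3 - x) / (x - 2), by norm_num, div_pos (by linarith) (by linarith), ?_⟩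
    have : x - 2 ≠ 0 := by linarith
    simp only [digitBranch, Branch.act, branch₄]; push_cast; field_simp; ring
  · refine ⟨5, x - 3, by norm_num, by linarith, ?_⟩
    simp only [digitBranch, Branch.act, branch₅]; push_cast; field_simp; ring

/-- An orbit of the reduction algorithm together with the backward variable. -/
structure Orbit (d : ℕ → ℕ) (x y : ℕ → ℝ) : Prop where
  x_pos : ∀ n, 0 < x n
  y_pos : ∀ n, 0 < y n
  one_le : ∀ n, 1 ≤ d n
  le_five : ∀ n, d n ≤ 5
  x_step : ∀ n, x n = (digitBranch (d n)).act (x (n + 1))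
  y_step : ∀ n, y (n + 1) = (digitBranch (d n)).dual (y n)

lemma exists_orbit {x₀ y₀ : ℝ} (hx : 0 < x₀) (hi : Irrational x₀) (hy : 0 < y₀) :
    ∃ d x y, Orbit d x y ∧ x 0 = x₀ ∧ y 0 = y₀ := by
  choose k nx hk hpos hirr hact using
    fun u : {u : ℝ // 0 < u ∧ Irrational u} => exists_digit u.2.1 u.2.2
  let next : {u : ℝ // 0 < u ∧ Irrational u} → {u : ℝ // 0 < u ∧ Irrational u} :=
    fun u => ⟨nx u, hpos u, hirr u⟩
  let s : ℕ → {u : ℝ // 0 < u ∧ Irrational u} := fun n => next^[n] ⟨x₀, hx, hi⟩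
  let y : ℕ → ℝ := fun n => Nat.rec y₀ (fun n v => (digitBranch (k (s n))).dual v) n
  refine ⟨fun n => k (s n), fun n => s n, y, ⟨fun n => (s n).2.1, fun n => ?_,
    fun n => (hk (s n)).1, fun n => (hk (s n)).2, fun n => ?_, fun n => rfl⟩, rfl, rfl⟩
  · induction n with
    | zero => exact hy
    | succ n ih => exact (digitBranch (k (s n))).dual_pos ih
  · have : s (n + 1) = next (s n) := Function.iterate_succ_apply' _ _ _
    simp only [this]
    exact hact (s n)

namespace Orbit

variable {d : ℕ → ℕ} {x y : ℕ → ℝ}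

lemma shift (O : Orbit d x y) (m : ℕ) :
    Orbit (fun n => d (n + m)) (fun n => x (n + m)) (fun n => y (n + m)) :=
  ⟨fun _ => O.x_pos _, fun _ => O.y_pos _, fun _ => O.one_le _, fun _ => O.le_five _,
    fun n => by simp only [Nat.add_right_comm n 1 m]; exact O.x_step _,
    fun n => by simp only [Nat.add_right_comm n 1 m]; exact O.y_step _⟩

/-- The first `n` branches applied to an integral vector. -/
def lift (d : ℕ → ℕ) : ℕ → ℕ × ℕ → ℕ × ℕ
  | 0, v => v
  | n + 1, v => (digitBranch (d 0)).mul (lift (fun i => d (i + 1)) n v)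

/-- Telescoped `Branch.height_mul`: heights at time `n` are heights of actual fractions for the
initial point. -/
lemma height_lift (n : ℕ) : ∀ {d : ℕ → ℕ} {x y : ℕ → ℝ}, Orbit d x y → ∀ v,
    height (x 0) (y 0) (lift d n v) = height (x n) (y n) v := by
  induction n with
  | zero => intros; rfl
  | succ n ih =>
    intro d x y O v
    have := ih (O.shift 1) v
    simp only [zero_add] at this
    rw [← this, lift, O.x_step 0, (digitBranch (d 0)).height_mul (O.x_pos 1) (O.y_pos 0),
      ← O.y_step 0]

lemma coprime_lift (n : ℕ) : ∀ (d : ℕ → ℕ) (v : ℕ × ℕ), Nat.Coprime v.1 v.2 →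
    Nat.Coprime (lift d n v).1 (lift d n v).2 := by
  induction n with
  | zero => intro d v h; exact h
  | succ n ih => intro d v h; rw [lift, Branch.coprime_mul_iff]; exact ih _ v h

lemma mul_eq_zero_iff (g : Branch) {v : ℕ × ℕ} (h : g.mul v = 0) : v = 0 := by
  have h0 : g.mul 0 = 0 := by simp [Branch.mul]
  exact g.mul_injective (h.trans h0.symm)

lemma lift_ne_zero (n : ℕ) : ∀ (d : ℕ → ℕ) {v : ℕ × ℕ}, v ≠ 0 → lift d n v ≠ 0 := by
  induction n with
  | zero => intro d v h; exact h
  | succ n ih => intro d v h h'; exact ih _ h (mul_eq_zero_iff _ h')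

/-- Every vector is eventually left behind by the nested cones of the orbit. -/
def Escapes (d : ℕ → ℕ) (w : ℕ × ℕ) : Prop := ∃ N, ∀ n ≥ N, ∀ v ≠ 0, lift d n v ≠ w

lemma escapes_of_mul {u w : ℕ × ℕ} (hu : (digitBranch (d 0)).mul u = w)
    (h : Escapes (fun i => d (i + 1)) u) : Escapes d w := by
  obtain ⟨N, hN⟩ := h
  refine ⟨N + 1, fun n hn v hv he => ?_⟩
  obtain ⟨m, rfl⟩ : ∃ m, n = m + 1 := ⟨n - 1, by omega⟩
  exact hN m (by omega) v hv ((digitBranch (d 0)).mul_injective (he.trans hu.symm))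

lemma escapes_of_forall_ne {w : ℕ × ℕ} (h : ∀ u ≠ 0, (digitBranch (d 0)).mul u ≠ w) :
    Escapes d w := by
  refine ⟨1, fun n hn v hv => ?_⟩
  obtain ⟨m, rfl⟩ : ∃ m, n = m + 1 := ⟨n - 1, by omega⟩
  exact h _ (lift_ne_zero m _ hv)

/-- Branches increase the coordinate sum, except that `branch₁` fixes `(0, k)` and `branch₅` fixes
`(k, 0)`. These axis vectors are the only obstacle to descent in `escapes`. -/
lemma digit_ne {u : ℕ × ℕ} {k : ℕ} (hk : 1 ≤ k ∧ k ≤ 5) :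
    (k ≠ 1 → ((digitBranch k).mul u).1 = 0 → u = 0) ∧
    (k ≠ 5 → ((digitBranch k).mul u).2 = 0 → u = 0) ∧
    (u ≠ 0 → u.1 + u.2 < ((digitBranch k).mul u).1 + ((digitBranch k).mul u).2 ∨
      ((digitBranch k).mul u = u ∧ (u.1 = 0 ∨ u.2 = 0))) := by
  obtain ⟨p, q⟩ := u
  obtain ⟨h1, h2⟩ := hk
  interval_cases k <;>
  simp [digitBranch, Branch.mul, branch₁, branch₂, branch₃, branch₄, branch₅] <;> omega

/-- The digit 1 cannot persist, since each use lowers `1 / x` by one; any other digit expels the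
axis vector from the cone. -/
lemma escapes_left (K : ℕ) : ∀ {d : ℕ → ℕ} {x y : ℕ → ℝ}, Orbit d x y → 1 / x 0 ≤ K →
    ∀ k, Escapes d (0, k) := by
  induction K with
  | zero =>
    intro d x y O h
    have := O.x_pos 0
    have : 0 < 1 / x 0 := by positivity
    push_cast at h
    linarith
  | succ K ih =>
    intro d x y O h k
    by_cases h1 : d 0 = 1
    · refine escapes_of_mul (u := (0, k)) (by simp [h1, digitBranch, branch₁, Branch.mul])
        (ih (O.shift 1) ?_ k)
      have e := O.x_step 0
      have hp := O.x_pos 1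
      rw [h1] at e
      simp only [digitBranch, Branch.act, branch₁] at e
      push_cast at e h
      rw [e] at h
      have : 1 / ((1 * x (0 + 1) + 0) / (1 * x (0 + 1) + 1)) = 1 + 1 / x 1 := by
        field_simp; simp
      rw [this] at h
      simp only [zero_add]
      linarith
    · refine escapes_of_forall_ne fun u hu he => hu ?_
      exact (digit_ne ⟨O.one_le 0, O.le_five 0⟩).1 h1 (by rw [he])

/-- Each digit 5 lowers `x` by `3`, so it cannot persist. -/
lemma escapes_right (K : ℕ) : ∀ {d : ℕ → ℕ} {x y : ℕ → ℝ}, Orbit d x y → x 0 ≤ K →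
    ∀ k, Escapes d (k, 0) := by
  induction K with
  | zero =>
    intro d x y O h
    have := O.x_pos 0
    push_cast at h
    linarith
  | succ K ih =>
    intro d x y O h k
    by_cases h1 : d 0 = 5
    · refine escapes_of_mul (u := (k, 0)) (by simp [h1, digitBranch, branch₅, Branch.mul])
        (ih (O.shift 1) ?_ k)
      have e := O.x_step 0
      rw [h1] at e
      simp only [digitBranch, Branch.act, branch₅] at e
      push_cast at e h
      simp only [zero_add, one_mul, zero_mul, div_one] at e ⊢
      linarith
    · refine escapes_of_forall_ne fun u hu he => hu ?_
      exact (digit_ne ⟨O.one_le 0, O.le_five 0⟩).2.1 h1 (by rw [he])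

lemma escapes (s : ℕ) : ∀ {d : ℕ → ℕ} {x y : ℕ → ℝ}, Orbit d x y → ∀ w : ℕ × ℕ,
    w.1 + w.2 ≤ s → Escapes d w := by
  induction s with
  | zero =>
    intro d x y O w hw
    have : w = 0 := Prod.ext (by simp; omega) (by simp; omega)
    exact ⟨0, fun n _ v hv => this ▸ lift_ne_zero n d hv⟩
  | succ s ih =>
    intro d x y O w hw
    by_cases hex : ∃ u, u ≠ 0 ∧ (digitBranch (d 0)).mul u = w
    · obtain ⟨u, hu, rfl⟩ := hex
      rcases (digit_ne (u := u) ⟨O.one_le 0, O.le_five 0⟩).2.2 hu with h | ⟨h, h' | h'⟩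
      · exact escapes_of_mul rfl (ih (O.shift 1) u (by omega))
      · rw [h]
        obtain ⟨K, hK⟩ := exists_nat_ge (1 / x 0)
        have : u = (0, u.2) := Prod.ext h' rfl
        rw [this]
        exact escapes_left K O hK _
      · rw [h]
        obtain ⟨K, hK⟩ := exists_nat_ge (x 0)
        have : u = (u.1, 0) := Prod.ext rfl h'
        rw [this]
        exact escapes_right K O hK _
    · push Not at hex
      exact escapes_of_forall_ne hex

/-- A generator of small height at time `n` lifts to a coprime vector of the same height, hence to
one of finitely many vectors or an axis generator; all of these are eventually left behind. -/
lemma eventually_lt_height (O : Orbit d x y) {μ : ℝ} (hf : (goodPairs (x 0) (y 0) μ).Finite) :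
    ∀ᶠ n in atTop, μ < height (x n) (y n) (1, 0) ∧ μ < height (x n) (y n) (0, 1) := by
  set T := goodPairs (x 0) (y 0) μ ∪ {(1, 0), (0, 1)} with hT
  have hTf : T.Finite := hf.union (by simp)
  have hev : ∀ᶠ n in atTop, ∀ w ∈ T, ∀ v ≠ 0, lift d n v ≠ w := by
    rw [Filter.eventually_all_finite hTf]
    intro w _
    obtain ⟨N, hN⟩ := escapes (w.1 + w.2) O w le_rfl
    exact eventually_atTop.2 ⟨N, hN⟩
  have key : ∀ n, (∀ w ∈ T, ∀ v ≠ 0, lift d n v ≠ w) → ∀ v ≠ 0, Nat.Coprime v.1 v.2 →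
      μ < height (x n) (y n) v := by
    intro n hn v hv hc
    by_contra hle
    push Not at hle
    rw [← height_lift n O] at hle
    have hc' := coprime_lift n d v hc
    refine hn (lift d n v) ?_ v hv rfl
    rcases Nat.eq_zero_or_pos (lift d n v).1 with h1 | h1
    · right; right
      rw [h1, Nat.coprime_zero_left] at hc'
      exact Prod.ext h1 hc'
    rcases Nat.eq_zero_or_pos (lift d n v).2 with h2 | h2
    · right; left
      rw [h2, Nat.coprime_zero_right] at hc'
      exact Prod.ext hc' h2
    · exact Or.inl ⟨h1, h2, hc', hle⟩
  filter_upwards [hev] with n hn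
  exact ⟨key n hn _ (by simp) (by norm_num), key n hn _ (by simp) (by norm_num)⟩

end Orbit

/-! ### The spectrum of positive irrationals -/

lemma height_one_zero {x y : ℝ} : height x y (1, 0) = 1 / (x + y) := by
  simp [height, weight]

lemma height_zero_one {x y : ℝ} (hx : 0 < x) : height x y (0, 1) = x * y / (3 * (x + y)) := by
  simp only [height, weight]
  simp only [dvd_zero, if_true, CharP.cast_eq_zero, Nat.cast_one, mul_one, zero_sub, abs_neg,
    abs_of_pos hx, zero_add]
  rw [← div_div]
  ring

/-- The inequalities at a crossed edge confine both end points to `(1, 3)`. -/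
lemma bounds_of_heights {x y : ℝ} (hx : 0 < x) (hy : 0 < y)
    (h1 : 1 / 4 < height x y (1, 0)) (h2 : 1 / 4 < height x y (0, 1)) :
    x + y < 4 ∧ 3 / x + 3 / y < 4 ∧ 1 < x ∧ x < 3 ∧ 1 < y ∧ y < 3 := by
  rw [height_one_zero, one_div_lt_one_div (by norm_num) (by positivity)] at h1
  rw [height_zero_one hx, lt_div_iff₀ (by positivity)] at h2
  have h3 : 3 / x + 3 / y < 4 := by
    rw [div_add_div _ _ hx.ne' hy.ne', div_lt_iff₀ (by positivity)]
    linarith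
  have hs : 3 < x + y := by nlinarith [sq_nonneg (x - y)]
  -- The products force `x` and `y` onto the same side of `1` and of `3`; the bounds `3 < x + y < 4`
  -- select the side.
  have p1 : 0 < (x - 1) * (y - 1) := by nlinarith
  have p3 : 0 < (3 - x) * (3 - y) := by nlinarith
  refine ⟨h1, h3, ?_, ?_, ?_, ?_⟩
  · by_contra h; push Not at h; nlinarith
  · by_contra h; push Not at h; nlinarith
  · by_contra h; push Not at h; nlinarith
  · by_contra h; push Not at h; nlinarith

lemma Orbit.tight {d : ℕ → ℕ} {x y : ℕ → ℝ} (O : Orbit d x y)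
    (h : ∀ n, 1 / 4 < height (x n) (y n) (1, 0) ∧ 1 / 4 < height (x n) (y n) (0, 1)) :
    TightOrbit d x y := by
  have hb := fun n => bounds_of_heights (O.x_pos n) (O.y_pos n) (h n).1 (h n).2
  refine ⟨fun n => (hb n).2.2.1, fun n => (hb n).2.2.2.2.1, fun n => (hb n).2.2.2.1,
    fun n => (hb n).2.2.2.2.2, fun n => (hb n).1, fun n => (hb n).2.1, fun n => ?_⟩
  have h1 := O.x_step n
  have h2 := O.y_step n
  obtain ⟨-, -, hx1, hx3, -, -⟩ := hb n
  have hx' := O.x_pos (n + 1)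
  have hy := O.y_pos n
  have hl := O.one_le n
  have hu := O.le_five n
  generalize hk : d n = k at *
  interval_cases k
  · exfalso
    simp only [digitBranch, Branch.act, branch₁] at h1
    push_cast at h1
    rw [h1, lt_div_iff₀ (by positivity)] at hx1
    linarith
  · left
    refine ⟨rfl, h1.trans (branch₂_act hx'), h2.trans ?_⟩
    simp only [digitBranch, Branch.dual, branch₂]; push_cast; field_simp; ring
  · right; left
    refine ⟨rfl, h1.trans (branch₃_act hx'), h2.trans ?_⟩
    simp only [digitBranch, Branch.dual, branch₃]; push_cast; field_simp; ring
  · right; right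
    refine ⟨rfl, h1.trans (branch₄_act hx'), h2.trans ?_⟩
    simp only [digitBranch, Branch.dual, branch₄]; push_cast; field_simp; ring
  · exfalso
    simp only [digitBranch, Branch.act, branch₅] at h1
    push_cast at h1
    rw [h1] at hx3
    simp only [zero_mul, one_mul, zero_add, div_one] at hx3
    linarith

/-- The constant of `x` is one of the four largest possible values, or at most `peak 3`. -/
def InSpectrum (x : ℝ) : Prop :=
  ConstEq x (peak 0) ∨ ConstEq x (1 / √13) ∨ ConstEq x (peak 1) ∨ ConstEq x (peak 2) ∨
    ConstLE x (peak 3)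

lemma IsSpecial.inSpectrum {u : ℝ} (hu : 0 < u) (h : IsSpecial u) : InSpectrum u := by
  rcases h with h | ⟨j, h⟩
  · exact Or.inr (Or.inl (constEq_of_fixed_two hu h))
  · rcases le_or_gt 3 j with h3 | h3
    · exact Or.inr (Or.inr (Or.inr (Or.inr ((constLE_of_fixed_word hu h).mono (peak_antitone h3)))))
    · interval_cases j
      · exact Or.inl (constEq_of_fixed_word_zero hu h)
      · exact Or.inr (Or.inr (Or.inl (constEq_of_fixed_word_one hu h)))
      · exact Or.inr (Or.inr (Or.inr (Or.inl (constEq_of_fixed_word_two hu h))))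

lemma InSpectrum.act {x : ℝ} (hx : 0 < x) (g : Branch) (h : InSpectrum x) :
    InSpectrum (g.act x) := by
  rcases h with h | h | h | h | h
  · exact Or.inl (h.act hx g)
  · exact Or.inr (Or.inl (h.act hx g))
  · exact Or.inr (Or.inr (Or.inl (h.act hx g)))
  · exact Or.inr (Or.inr (Or.inr (Or.inl (h.act hx g))))
  · exact Or.inr (Or.inr (Or.inr (Or.inr (h.act hx g))))

lemma InSpectrum.flip {x : ℝ} (hx : 0 < x) (h : InSpectrum x) : InSpectrum (3 / x) := by
  rcases h with h | h | h | h | h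
  · exact Or.inl (h.flip hx)
  · exact Or.inr (Or.inl (h.flip hx))
  · exact Or.inr (Or.inr (Or.inl (h.flip hx)))
  · exact Or.inr (Or.inr (Or.inr (Or.inl (h.flip hx))))
  · exact Or.inr (Or.inr (Or.inr (Or.inr (h.flip hx))))

lemma Orbit.inSpectrum_zero {d : ℕ → ℕ} {x y : ℕ → ℝ} (O : Orbit d x y) (n : ℕ)
    (h : InSpectrum (x n)) : InSpectrum (x 0) := by
  induction n with
  | zero => exact h
  | succ n ih =>
    refine ih ?_
    rw [O.x_step n]
    exact h.act (O.x_pos _) _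

/-- Every positive irrational satisfies `InSpectrum`. -/
theorem inSpectrum_of_irrational {x : ℝ} (hx : 0 < x) (hi : Irrational x) : InSpectrum x := by
  -- Infinitely many fractions of height at most `1/4` already bound the constant by `peak 3`, so
  -- only the finite case needs the orbit.
  by_cases hf : (goodPairs x 1 (1 / 4)).Finite
  · obtain ⟨d, u, y, O, rfl, hy⟩ := exists_orbit hx hi one_pos
    have hf : (goodPairs (u 0) (y 0) (1 / 4)).Finite := by rwa [hy]
    obtain ⟨N, hN⟩ := eventually_atTop.1 (O.eventually_lt_height hf)
    have T := (O.shift N).tight fun n => hN (n + N) (by omega)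
    obtain ⟨n, h⟩ := T.exists_special
    have hp := O.x_pos (n + N)
    refine O.inSpectrum_zero (n + N) ?_
    rcases h with h | h
    · exact h.inSpectrum hp
    · have := (h.inSpectrum (by positivity)).flip (by positivity)
      rwa [show 3 / (3 / u (n + N)) = u (n + N) by field_simp] at this
  · exact Or.inr (Or.inr (Or.inr (Or.inr
      ((ConstLE.of_infinite hx one_pos hf).mono (quarter_le_peak 3)))))

/-! ### Parametrisation of Eisenstein pairs and the distance to a half-line -/

open Eisenstein

lemma norm_sq_add_mul_omega (s t : ℝ) :
    ‖(s : ℂ) + (t : ℂ) * omega‖ ^ 2 = s ^ 2 + s * t + t ^ 2 := by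
  have h3 : √3 ^ 2 = (3 : ℝ) := Real.sq_sqrt (by norm_num)
  have e : (s : ℂ) + (t : ℂ) * omega = ((s + t / 2 : ℝ) : ℂ) + ((t * √3 / 2 : ℝ) : ℂ) * Complex.I := by
    unfold omega; push_cast; ring
  rw [e, ← Complex.normSq_eq_norm_sq, Complex.normSq_add_mul_I]
  linear_combination t ^ 2 / 4 * h3

lemma norm_point_sq (p : EPair) :
    ‖point p‖ ^ 2 = (p.1.1 : ℝ) ^ 2 + p.1.1 * p.1.2 + (p.1.2 : ℝ) ^ 2 := by
  rw [← norm_sq_add_mul_omega]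
  simp [point]

lemma finite_epair_of_le (K : ℝ) : {p : EPair | (p.1.1 : ℝ) + p.1.2 ≤ K}.Finite :=
  Set.Finite.of_injOn (f := Subtype.val) (t := {v : ℕ × ℕ | (v.1 : ℝ) + v.2 ≤ K})
    (fun _ h => h) Subtype.val_injective.injOn (finite_of_add_le K fun _ h => h)

lemma comap_norm_point : comap (fun p : EPair => ‖point p‖) atTop = cofinite := by
  apply le_antisymm
  · rw [le_cofinite_iff_compl_singleton_mem]
    intro p
    refine ⟨Set.Ioi ‖point p‖, Ioi_mem_atTop _, fun q hq => ?_⟩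
    rintro rfl
    exact lt_irrefl _ (show ‖point q‖ < ‖point q‖ from hq)
  · rw [← tendsto_iff_comap, tendsto_atTop]
    intro K
    rw [eventually_cofinite]
    refine (finite_epair_of_le (2 * |K|)).subset fun p hp => ?_
    have h := norm_point_sq p
    simp only [Set.mem_ofPred_eq, not_le] at hp ⊢
    have h0 := norm_nonneg (point p)
    have h1 : ‖point p‖ < |K| := hp.trans_le (le_abs_self K)
    have ha : (0 : ℝ) ≤ p.1.1 := by positivity
    have hb : (0 : ℝ) ≤ p.1.2 := by positivity
    have h2 : (p.1.1 : ℝ) ≤ ‖point p‖ := abs_le_of_sq_le_sq' (by nlinarith) h0 |>.2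
    have h3 : (p.1.2 : ℝ) ≤ ‖point p‖ := abs_le_of_sq_le_sq' (by nlinarith) h0 |>.2
    linarith

lemma delta_eq (z : ℂ) : delta z = liminf (fun p : EPair => delta' z p) cofinite := by
  rw [delta, comap_norm_point]

/-- The distance from a lattice point to a half-line inside the sector. -/
lemma delta'_eq {α β : ℝ} (hα : 0 ≤ α) (hβ : 0 ≤ β) (h : α ^ 2 + α * β + β ^ 2 = 1) (p : EPair) :
    delta' ((α : ℂ) + (β : ℂ) * omega) p =
      ENNReal.ofReal (√3 / 2 * |(p.1.1 : ℝ) * β - p.1.2 * α|) := by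
  obtain ⟨a, ha⟩ : ∃ a : ℝ, a = p.1.1 := ⟨_, rfl⟩
  obtain ⟨b, hb⟩ : ∃ b : ℝ, b = p.1.2 := ⟨_, rfl⟩
  have ha0 : 0 ≤ a := by rw [ha]; positivity
  have hb0 : 0 ≤ b := by rw [hb]; positivity
  rw [← ha, ← hb]
  have hpt : point p = (a : ℂ) + (b : ℂ) * omega := by rw [ha, hb]; simp [point]
  -- The real inner product of the two vectors; it is nonnegative in the sector, so the foot of the
  -- perpendicular lies on the half-line.
  obtain ⟨t₀, ht₀⟩ : ∃ t₀, t₀ = a * α + (a * β + b * α) / 2 + b * β := ⟨_, rfl⟩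
  have ht0 : 0 ≤ t₀ := by rw [ht₀]; positivity
  have h3 : √3 ^ 2 = (3 : ℝ) := Real.sq_sqrt (by norm_num)
  have hdist : ∀ t : ℝ, dist (point p) ((t : ℂ) * ((α : ℂ) + (β : ℂ) * omega)) ^ 2 =
      (t - t₀) ^ 2 + (√3 / 2 * |a * β - b * α|) ^ 2 := by
    intro t
    have e : point p - (t : ℂ) * ((α : ℂ) + (β : ℂ) * omega) =
        ((a - t * α : ℝ) : ℂ) + ((b - t * β : ℝ) : ℂ) * omega := by
      rw [hpt]; push_cast; ring
    rw [dist_eq_norm, e, norm_sq_add_mul_omega, mul_pow, sq_abs, ht₀]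
    linear_combination (t ^ 2 - a ^ 2 - a * b - b ^ 2) * h + (-(a * β - b * α) ^ 2 / 4) * h3
  unfold delta'
  apply le_antisymm
  · have hm : (t₀ : ℂ) * ((α : ℂ) + (β : ℂ) * omega) ∈ ray ((α : ℂ) + (β : ℂ) * omega) :=
      ⟨t₀, ht0, rfl⟩
    refine (Metric.infEDist_le_edist_of_mem hm).trans ?_
    rw [edist_dist]
    refine ENNReal.ofReal_le_ofReal (abs_le_of_sq_le_sq' ?_ (by positivity)).2
    rw [hdist, sub_self]; simp
  · refine Metric.le_infEDist.2 ?_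
    rintro _ ⟨t, -, rfl⟩
    rw [edist_dist]
    refine ENNReal.ofReal_le_ofReal (abs_le_of_sq_le_sq' ?_ dist_nonneg).2
    rw [hdist]
    nlinarith [sq_nonneg (t - t₀)]

/-- The point of the arc with parameter `x`. -/
noncomputable def arcPoint (x : ℝ) : ℂ :=
  (((x ^ 2 + 2 * x) / (x ^ 2 + 3 * x + 3) : ℝ) : ℂ) +
    (((2 * x + 3) / (x ^ 2 + 3 * x + 3) : ℝ) : ℂ) * omega

/-- The conjugate parameter for which `height` is proportional to the distance. -/
noncomputable def conjParam (x : ℝ) : ℝ := (3 * x + 6) / (2 * x + 3)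

lemma conjParam_pos {x : ℝ} (hx : 0 < x) : 0 < conjParam x := by unfold conjParam; positivity

lemma arcPoint_mem {x : ℝ} (hx : 0 < x) : arcPoint x ∈ arc :=
  ⟨_, _, by positivity, by positivity, by field_simp; ring, rfl⟩

/-- `p` is `d` times the primitive pair with parameter `v`. -/
def HasParam (p : EPair) (d : ℕ) (v : ℕ × ℕ) : Prop :=
  (p.1.1 : ℝ) = d * weight v.1 * ((v.1 : ℝ) ^ 2 + 2 * v.1 * v.2) ∧
  (p.1.2 : ℝ) = d * weight v.1 * (2 * (v.1 : ℝ) * v.2 + 3 * (v.2 : ℝ) ^ 2)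

/-- The determinant of the pair against the direction factors as `p - x q` times a positive linear
form in `p, q`, whose slope is `conjParam x`. -/
lemma delta'_arcPoint {x : ℝ} (hx : 0 < x) {p : EPair} {d : ℕ} {v : ℕ × ℕ} (h : HasParam p d v) :
    delta' (arcPoint x) p = ENNReal.ofReal (√3 * (d * height x (conjParam x) v)) := by
  unfold arcPoint
  rw [delta'_eq (by positivity) (by positivity) (by field_simp; ring), h.1, h.2]
  have hw := weight_pos v.1
  have e : (d : ℝ) * weight v.1 * ((v.1 : ℝ) ^ 2 + 2 * v.1 * v.2) *
      ((2 * x + 3) / (x ^ 2 + 3 * x + 3)) - d * weight v.1 * (2 * (v.1 : ℝ) * v.2 + 3 * (v.2 : ℝ) ^ 2) *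
      ((x ^ 2 + 2 * x) / (x ^ 2 + 3 * x + 3)) =
      ((v.1 : ℝ) - x * v.2) * (d * weight v.1 *
        ((2 * x + 3) * v.1 + (3 * x + 6) * v.2) / (x ^ 2 + 3 * x + 3)) := by
    field_simp; ring
  have hn : (0 : ℝ) ≤ d * weight v.1 *
        ((2 * x + 3) * v.1 + (3 * x + 6) * v.2) / (x ^ 2 + 3 * x + 3) := by positivity
  have e2 : x + conjParam x = 2 * (x ^ 2 + 3 * x + 3) / (2 * x + 3) := by
    unfold conjParam; field_simp; ring
  rw [e, abs_mul, abs_of_nonneg hn, height, e2, conjParam]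
  congr 1
  field_simp

lemma exists_epair {v : ℕ × ℕ} (h1 : 0 < v.1) (h2 : 0 < v.2) {d : ℕ} (hd : 0 < d) :
    ∃ p : EPair, HasParam p d v := by
  obtain ⟨p, q⟩ := v
  simp only at h1 h2
  have key : ∀ a b c : ℕ, 0 < a → 0 < b → a ^ 2 + a * b + b ^ 2 = c ^ 2 →
      IsEisensteinPair (a, b) := fun a b c ha hb h => ⟨ha, hb, c, by simp only; rw [h]; ring⟩
  by_cases h3 : 3 ∣ p
  · obtain ⟨r, rfl⟩ := h3
    have hr : 0 < r := by omega
    refine ⟨⟨(d * (3 * r ^ 2 + 2 * r * q), d * (2 * r * q + q ^ 2)),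
      key _ _ (d * (3 * r ^ 2 + 3 * r * q + q ^ 2)) (by positivity) (by positivity) (by ring)⟩, ?_, ?_⟩ <;>
    · simp only [weight, Nat.dvd_mul_right, if_true]
      push_cast; ring
  · refine ⟨⟨(d * (p ^ 2 + 2 * p * q), d * (2 * p * q + 3 * q ^ 2)),
      key _ _ (d * (p ^ 2 + 3 * p * q + 3 * q ^ 2)) (by positivity) (by positivity) (by ring)⟩, ?_, ?_⟩ <;>
    · simp only [weight, h3, if_false]
      push_cast; ring

/-- With `c² = a² + ab + b²`, the parameter is `p / q = (a + c - b) / b` in lowest terms. The two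
quadratic expressions in `p, q` have common divisor `3` or `1` according to whether `3 ∣ p`. -/
lemma exists_param (p : EPair) :
    ∃ d v, 0 < d ∧ 0 < v.1 ∧ 0 < v.2 ∧ Nat.Coprime v.1 v.2 ∧ HasParam p d v := by
  obtain ⟨⟨a, b⟩, ha, hb, c, hc⟩ := p
  simp only at ha hb hc
  have hcb : b < c := by
    by_contra h
    push Not at h
    have := Nat.mul_le_mul h h
    nlinarith
  obtain ⟨e, rfl⟩ : ∃ e, c = b + e := ⟨c - b, by omega⟩
  have hP : 0 < a + e := by omega
  obtain ⟨g, p, q, hg, hpq, e1, e2⟩ := Nat.exists_coprime' (m := a + e) (n := b) (Nat.gcd_pos_of_pos_left _ hP)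
  have hp0 : 0 < p := Nat.pos_of_ne_zero fun h => by rw [h] at e1; omega
  have hq0 : 0 < q := Nat.pos_of_ne_zero fun h => by rw [h] at e2; omega
  have hrel : a * (2 * (a + e) + 3 * b) = (a + e) * ((a + e) + 2 * b) := by nlinarith
  have hab : a * (q * (2 * p + 3 * q)) = b * (p * (p + 2 * q)) := by
    rw [e1, e2] at hrel
    have : g * (a * (2 * p + 3 * q)) = g * (g * (p * (p + 2 * q))) := by linarith
    have := Nat.eq_of_mul_eq_mul_left hg this
    rw [e2]
    calc a * (q * (2 * p + 3 * q)) = q * (a * (2 * p + 3 * q)) := by ring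
      _ = _ := by rw [this]; ring
  have hqp := hpq.symm
  have key : ∀ A B : ℕ, 0 < A → 0 < B → Nat.Coprime A B → a * B = b * A →
      ∃ d, 0 < d ∧ a = d * A ∧ b = d * B := by
    intro A B hA hB hAB h
    have h1 : A ∣ a := hAB.dvd_of_dvd_mul_right (h ▸ Dvd.intro_left b rfl)
    obtain ⟨d, rfl⟩ := h1
    refine ⟨d, Nat.pos_of_mul_pos_left ha, mul_comm _ _, ?_⟩
    have : A * (d * B) = A * b := by linarith
    exact (Nat.eq_of_mul_eq_mul_left hA this).symm
  by_cases h3 : 3 ∣ p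
  · obtain ⟨r, rfl⟩ := h3
    have hr : 0 < r := by omega
    have hrq : Nat.Coprime r q := Nat.Coprime.coprime_mul_left hpq
    have hcop : Nat.Coprime (r * (3 * r + 2 * q)) (q * (2 * r + q)) := by
      refine Nat.Coprime.mul_left (Nat.Coprime.mul_right hrq ?_) (Nat.Coprime.mul_right ?_ ?_)
      · rw [← Nat.isCoprime_iff_coprime] at hrq ⊢
        obtain ⟨s, t, h⟩ := hrq
        exact ⟨s - 2 * t, t, by push_cast; linear_combination h⟩
      · rw [← Nat.isCoprime_iff_coprime] at hpq ⊢
        obtain ⟨s, t, h⟩ := hpq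
        exact ⟨s, t - 2 * s, by push_cast at h ⊢; linear_combination h⟩
      · rw [← Nat.isCoprime_iff_coprime] at hrq ⊢
        obtain ⟨s, t, h⟩ := hrq
        exact ⟨2 * t - s, 2 * s - 3 * t, by push_cast; linear_combination h⟩
    obtain ⟨d, hd, h1, h2⟩ := key _ _ (by positivity) (by positivity) hcop (by
      have h9 : 3 * (a * (q * (2 * r + q))) = 3 * (b * (r * (3 * r + 2 * q))) := by nlinarith
      omega)
    refine ⟨d, (3 * r, q), hd, hp0, hq0, hpq, ?_, ?_⟩
    · simp only [weight, Nat.dvd_mul_right, if_true]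
      rw [h1]; push_cast; ring
    · simp only [weight, Nat.dvd_mul_right, if_true]
      rw [h2]; push_cast; ring
  · have h3p : Nat.Coprime 3 p := (Nat.Prime.coprime_iff_not_dvd Nat.prime_three).2 h3
    have h3q : Nat.Coprime p (3 * q) := Nat.Coprime.mul_right h3p.symm hpq
    have hcop : Nat.Coprime (p * (p + 2 * q)) (q * (2 * p + 3 * q)) := by
      refine Nat.Coprime.mul_left (Nat.Coprime.mul_right hpq ?_) (Nat.Coprime.mul_right ?_ ?_)
      · rw [← Nat.isCoprime_iff_coprime] at h3q ⊢
        obtain ⟨s, t, h⟩ := h3q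
        exact ⟨s - 2 * t, t, by push_cast at h ⊢; linear_combination h⟩
      · rw [← Nat.isCoprime_iff_coprime] at hpq ⊢
        obtain ⟨s, t, h⟩ := hpq
        exact ⟨s, t - 2 * s, by push_cast; linear_combination h⟩
      · rw [← Nat.isCoprime_iff_coprime] at hpq ⊢
        obtain ⟨s, t, h⟩ := hpq
        exact ⟨-3 * s + 2 * t, 2 * s - t, by push_cast; linear_combination h⟩
    obtain ⟨d, hd, h1, h2⟩ := key _ _ (by positivity) (by positivity) hcop hab
    refine ⟨d, (p, q), hd, hp0, hq0, hpq, ?_, ?_⟩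
    · simp only [weight, h3, if_false]
      rw [h1]; push_cast; ring
    · simp only [weight, h3, if_false]
      rw [h2]; push_cast; ring

lemma height_pos {x y : ℝ} (hx : 0 < x) (hy : 0 < y) (hi : Irrational x) {v : ℕ × ℕ}
    (h2 : 0 < v.2) : 0 < height x y v := by
  have hw := weight_pos v.1
  have hq : (0 : ℝ) < v.2 := by exact_mod_cast h2
  have hne : (v.1 : ℝ) - x * v.2 ≠ 0 := by
    intro h
    refine hi ⟨(v.1 : ℚ) / v.2, ?_⟩
    push_cast
    rw [div_eq_iff hq.ne']; linarith
  have := abs_pos.2 hne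
  unfold height
  positivity

/-! ### From approximation constants to `delta` -/

lemma le_delta_of_constGE {x μ : ℝ} (hx : 0 < x) (hi : Irrational x) (hμ : 0 < μ)
    (h : ConstGE x μ) : ENNReal.ofReal (√3 * μ) ≤ delta (arcPoint x) := by
  rw [delta_eq]
  choose dOf vOf hd h1 h2 hcop hpar using exists_param
  have h3 : 0 < √3 := by positivity
  have hy := conjParam_pos hx
  have hfin : ∀ μ' < μ, {p : EPair | √3 * (dOf p * height x (conjParam x) (vOf p)) ≤ √3 * μ'}.Finite := by
    intro μ' hμ'
    have hG := h _ hy μ' hμ'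
    set G := goodPairs x (conjParam x) μ'
    -- Irrationality makes each height positive, so only finitely many multiples of each primitive
    -- pair stay within the bound.
    have hH : (⋃ v ∈ G, (Set.Iic ⌊μ' / height x (conjParam x) v⌋₊ ×ˢ {v})).Finite :=
      hG.biUnion fun v _ => (Set.finite_Iic _).prod (Set.finite_singleton v)
    refine Set.Finite.of_injOn (f := fun p => (dOf p, vOf p)) ?_ ?_ hH
    · intro p hp
      simp only [Set.mem_ofPred_eq] at hp
      have hp' := le_of_mul_le_mul_left hp h3
      have hpos := height_pos hx hy hi (h2 p)
      have hd1 : (1 : ℝ) ≤ dOf p := by exact_mod_cast hd p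
      simp only [Set.mem_iUnion]
      refine ⟨vOf p, ⟨h1 p, h2 p, hcop p, ?_⟩, ?_, rfl⟩
      · nlinarith
      · simp only [Set.mem_Iic]
        rw [Nat.le_floor_iff' (hd p).ne', le_div_iff₀ hpos]
        exact hp'
    · intro p _ p' _ he
      simp only [Prod.mk.injEq] at he
      have e1 : (p.1.1 : ℝ) = p'.1.1 := by rw [(hpar p).1, (hpar p').1, he.1, he.2]
      have e2 : (p.1.2 : ℝ) = p'.1.2 := by rw [(hpar p).2, (hpar p').2, he.1, he.2]
      exact Subtype.ext (Prod.ext (by exact_mod_cast e1) (by exact_mod_cast e2))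
  refine le_of_forall_lt fun c hc => ?_
  obtain ⟨r, hr0, hcr, hr⟩ := ENNReal.lt_iff_exists_real_btwn.1 hc
  refine hcr.trans_le ?_
  have hr' := (ENNReal.ofReal_lt_ofReal_iff (by positivity)).1 hr
  refine le_liminf_of_le (by isBoundedDefault) ?_
  rw [eventually_cofinite]
  refine (hfin (r / √3) (by rw [div_lt_iff₀ h3]; linarith)).subset fun p hp => ?_
  simp only [Set.mem_ofPred_eq, not_le] at hp ⊢
  rw [delta'_arcPoint hx (hpar p)] at hp
  have := (ENNReal.ofReal_lt_ofReal_iff_of_nonneg (mul_nonneg h3.le (mul_nonneg (Nat.cast_nonneg _)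
    (height_nonneg hx hy _)))).1 hp
  rw [mul_div_cancel₀ _ h3.ne']
  exact this.le

lemma delta_le_of_constLE {x μ : ℝ} (hx : 0 < x) (h : ConstLE x μ) :
    delta (arcPoint x) ≤ ENNReal.ofReal (√3 * μ) := by
  rw [delta_eq]
  have h3 : 0 < √3 := by positivity
  have hy := conjParam_pos hx
  have key : ∀ μ' > μ, liminf (fun p : EPair => delta' (arcPoint x) p) cofinite ≤
      ENNReal.ofReal (√3 * μ') := by
    intro μ' hμ'
    refine liminf_le_of_frequently_le' ?_
    rw [frequently_cofinite_iff_infinite]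
    intro hf
    refine h _ hy μ' hμ' ?_
    obtain ⟨K, hK⟩ : ∃ K : ℝ, ∀ p ∈ {p : EPair | delta' (arcPoint x) p ≤ ENNReal.ofReal (√3 * μ')},
        (p.1.1 : ℝ) + p.1.2 ≤ K := by
      obtain ⟨K, hK⟩ := (hf.image fun p : EPair => (p.1.1 : ℝ) + p.1.2).bddAbove
      exact ⟨K, fun p hp => hK ⟨p, hp, rfl⟩⟩
    refine finite_of_add_le (3 * K) fun v hv => ?_
    obtain ⟨h1, h2, -, hF⟩ := hv
    obtain ⟨p, hp⟩ := exists_epair h1 h2 one_pos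
    have := hK p (by
      simp only [Set.mem_ofPred_eq]
      rw [delta'_arcPoint hx hp]
      refine ENNReal.ofReal_le_ofReal ?_
      push_cast
      rw [one_mul]
      gcongr)
    rw [hp.1, hp.2] at this
    have hw := third_le_weight v.1
    have r1 : (1 : ℝ) ≤ v.1 := by exact_mod_cast h1
    have r2 : (1 : ℝ) ≤ v.2 := by exact_mod_cast h2
    push_cast at this
    have hs : (v.1 : ℝ) + v.2 ≤ (v.1 : ℝ) ^ 2 + 2 * v.1 * v.2 + (2 * v.1 * v.2 + 3 * (v.2 : ℝ) ^ 2) := by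
      nlinarith
    have := mul_le_mul hw hs (by positivity) (weight_pos _).le
    linarith
  have hlim : Tendsto (fun μ' => ENNReal.ofReal (√3 * μ')) (nhdsWithin μ (Set.Ioi μ))
      (nhds (ENNReal.ofReal (√3 * μ))) := by
    refine (ENNReal.tendsto_ofReal ?_).mono_left nhdsWithin_le_nhds
    exact (continuous_const.mul continuous_id).tendsto μ
  exact ge_of_tendsto hlim (by filter_upwards [self_mem_nhdsWithin] with μ' hμ' using key μ' hμ')

lemma delta_eq_of_constEq {x μ : ℝ} (hx : 0 < x) (hi : Irrational x) (hμ : 0 < μ)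
    (h : ConstEq x μ) : delta (arcPoint x) = ENNReal.ofReal (√3 * μ) :=
  le_antisymm (delta_le_of_constLE hx h.2) (le_delta_of_constGE hx hi hμ h.1)

/-- The half-line passes through a pair and all of its multiples. -/
lemma delta_eq_zero_of_rational {x : ℝ} (hx : 0 < x) (hr : ¬ Irrational x) :
    delta (arcPoint x) = 0 := by
  unfold Irrational at hr
  push Not at hr
  obtain ⟨r, rfl⟩ := hr
  have hr0 : 0 < r := by exact_mod_cast hx
  obtain ⟨n, hnum⟩ : ∃ n : ℕ, (n : ℤ) = r.num :=
    ⟨r.num.toNat, Int.toNat_of_nonneg (Rat.num_pos.2 hr0).le⟩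
  have hn : 0 < n := by
    have := Rat.num_pos.2 hr0
    omega
  have hh : height r (conjParam r) (n, r.den) = 0 := by
    have e : (n : ℝ) = r * r.den := by
      have h2 : ((n : ℤ) : ℚ) = r * r.den := by rw [hnum, Rat.mul_den_eq_num]
      exact_mod_cast h2
    unfold height
    simp only [e, sub_self, abs_zero, mul_zero, zero_mul, zero_div]
  rw [delta_eq, ← nonpos_iff_eq_zero]
  refine liminf_le_of_frequently_le' ?_
  rw [frequently_cofinite_iff_infinite]
  choose P hP using fun d : ℕ => exists_epair (v := (n, r.den)) hn r.pos d.succ_pos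
  refine Set.infinite_of_injective_forall_mem (f := P) (fun d d' he => ?_) fun d => ?_
  · have h1 := (hP d).1
    rw [he, (hP d').1] at h1
    have hw := weight_pos n
    have hn' : (0 : ℝ) < n := by exact_mod_cast hn
    have hd' : (0 : ℝ) < r.den := by exact_mod_cast r.pos
    have hX : weight n * ((n : ℝ) ^ 2 + 2 * n * r.den) ≠ 0 := by positivity
    have h2 : (d'.succ : ℝ) * (weight n * ((n : ℝ) ^ 2 + 2 * n * r.den)) =
        d.succ * (weight n * ((n : ℝ) ^ 2 + 2 * n * r.den)) := by
      simp only at h1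
      linear_combination h1
    have := mul_right_cancel₀ hX h2
    have : d'.succ = d.succ := by exact_mod_cast this
    omega
  · simp only [Set.mem_ofPred_eq]
    rw [delta'_arcPoint hx (hP d), hh]; simp

/-! ### The end points of the arc -/

/-- Here `4c² = (2a + b)² + 3b²` and `2c ≥ 2a + b + 1`, so one coordinate bounds the other. -/
lemma four_mul_le_of_square {a b c : ℕ} (hb : 0 < b) (h : a ^ 2 + a * b + b ^ 2 = c * c) :
    4 * a ≤ 3 * b ^ 2 := by
  have h1 : 2 * a + b < 2 * c := by
    by_contra h'
    push Not at h'
    have := Nat.mul_le_mul h' h'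
    nlinarith
  have := Nat.mul_le_mul (Nat.succ_le_of_lt h1) (Nat.succ_le_of_lt h1)
  nlinarith

lemma delta_eq_top_of {α β : ℝ} (hα : 0 ≤ α) (hβ : 0 ≤ β) (h : α ^ 2 + α * β + β ^ 2 = 1)
    (hf : ∀ K : ℝ, {p : EPair | |(p.1.1 : ℝ) * β - p.1.2 * α| ≤ K}.Finite) :
    delta ((α : ℂ) + (β : ℂ) * omega) = ∞ := by
  rw [delta_eq]
  refine ENNReal.eq_top_of_forall_nnreal_le fun r => ?_
  refine le_liminf_of_le (by isBoundedDefault) ?_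
  rw [eventually_cofinite]
  refine (hf (2 * r)).subset fun p hp => ?_
  simp only [Set.mem_ofPred_eq, not_le] at hp ⊢
  rw [delta'_eq hα hβ h, ← ENNReal.ofReal_coe_nnreal] at hp
  have := (ENNReal.ofReal_lt_ofReal_iff_of_nonneg (by positivity)).1 hp
  have h3 : 1 ≤ √3 := Real.one_le_sqrt.2 (by norm_num)
  nlinarith [abs_nonneg ((p.1.1 : ℝ) * β - p.1.2 * α)]

lemma delta_one : delta 1 = ∞ := by
  have := delta_eq_top_of (α := 1) (β := 0) (by norm_num) (by norm_num) (by norm_num) fun K => by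
    refine (finite_epair_of_le (3 * K ^ 2 + K)).subset fun p hp => ?_
    obtain ⟨⟨a, b⟩, ha, hb, c, hc⟩ := p
    simp only [Set.mem_ofPred_eq, mul_zero, mul_one, zero_sub, abs_neg, Nat.abs_cast] at hp ⊢
    have h4 : (4 : ℝ) * a ≤ 3 * b ^ 2 := by exact_mod_cast four_mul_le_of_square hb hc
    have hb0 : (0 : ℝ) ≤ b := by positivity
    nlinarith
  simpa using this

lemma delta_omega : delta omega = ∞ := by
  have := delta_eq_top_of (α := 0) (β := 1) (by norm_num) (by norm_num) (by norm_num) fun K => by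
    refine (finite_epair_of_le (3 * K ^ 2 + K)).subset fun p hp => ?_
    obtain ⟨⟨a, b⟩, ha, hb, c, hc⟩ := p
    simp only [Set.mem_ofPred_eq, mul_zero, mul_one, sub_zero, Nat.abs_cast] at hp ⊢
    have h4 : (4 : ℝ) * b ≤ 3 * a ^ 2 := by
      exact_mod_cast four_mul_le_of_square (c := c) ha (by simp only at hc; rw [← hc]; ring)
    have hb0 : (0 : ℝ) ≤ a := by positivity
    nlinarith
  simpa using this

/-- The inverse parameter is the one of `exists_param`, with `c = 1`. -/
lemma eq_arcPoint {α β : ℝ} (hα : 0 ≤ α) (hβ : 0 < β) (h : α ^ 2 + α * β + β ^ 2 = 1) :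
    (α : ℂ) + (β : ℂ) * omega = arcPoint ((α + 1 - β) / β) := by
  have hS : 0 < 2 + 2 * α + β := by positivity
  have eR : ((α + 1 - β) / β) ^ 2 + 3 * ((α + 1 - β) / β) + 3 = (2 + 2 * α + β) / β ^ 2 := by
    field_simp; linear_combination h
  unfold arcPoint
  rw [eR]
  congr 3
  · rw [eq_div_iff (by positivity)]
    field_simp
    linear_combination h
  · field_simp
    ring

lemma arc_cases {z : ℂ} (hz : z ∈ arc) : z = 1 ∨ z = omega ∨ ∃ x > 0, z = arcPoint x := by
  obtain ⟨α, β, hα, hβ, h, rfl⟩ := hz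
  rcases hβ.eq_or_lt with rfl | hβ'
  · left
    have : α = 1 := by nlinarith
    simp [this]
  right
  rcases hα.eq_or_lt with rfl | hα'
  · left
    have : β = 1 := by nlinarith
    simp [this]
  right
  refine ⟨(α + 1 - β) / β, div_pos ?_ hβ', eq_arcPoint hα hβ' h⟩
  nlinarith

/-! ### Explicit extremal points and values -/

/-- The second coordinates `1, 13, 142, 1549, …` of the extremal points. -/
def comarkoff (j : ℕ) : ℕ := (pell j).1 + 3 * (pell j).2

/-- A number congruent to `3` modulo `4` is not a square. -/
lemma irrational_sqrt_four_mul_sq_sub_one {N : ℕ} (hN : 0 < N) :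
    Irrational √(4 * (N : ℝ) ^ 2 - 1) := by
  have e : 4 * (N : ℝ) ^ 2 - 1 = ((4 * N ^ 2 - 1 : ℕ) : ℝ) := by
    rw [Nat.cast_sub (by nlinarith)]; push_cast; ring
  rw [e, irrational_sqrt_natCast_iff]
  rintro ⟨r, hr⟩
  have h1 : r * r + 1 = 4 * N ^ 2 := by
    have : 1 ≤ 4 * N ^ 2 := by nlinarith
    omega
  have h2 : (r * r + 1) % 4 = 0 := by omega
  have h3 : r % 4 < 4 := Nat.mod_lt _ (by norm_num)
  rw [Nat.add_mod, Nat.mul_mod] at h2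
  interval_cases r % 4 <;> simp at h2

lemma exists_peak_point {j : ℕ} (hc : ∀ x > 0, (word j).act x = x → ConstEq x (peak j)) :
    ∃ z ∈ arc, z = ((markoff j / √(4 * (markoff j : ℝ) ^ 2 - 1) : ℝ) : ℂ) +
        ((comarkoff j / √(4 * (markoff j : ℝ) ^ 2 - 1) : ℝ) : ℂ) * omega ∧
      delta z = ENNReal.ofReal (√3 * peak j) := by
  have hpa := pell_pos j
  have hN : 0 < markoff j := by unfold markoff; omega
  have hN1 : (1 : ℝ) ≤ markoff j := by exact_mod_cast hN
  have hs := irrational_sqrt_four_mul_sq_sub_one hN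
  have hs2 : √(4 * (markoff j : ℝ) ^ 2 - 1) ^ 2 = 4 * (markoff j : ℝ) ^ 2 - 1 :=
    Real.sq_sqrt (by nlinarith)
  have hs0 : 0 < √(4 * (markoff j : ℝ) ^ 2 - 1) := Real.sqrt_pos.2 (by nlinarith)
  have hpk : 0 < peak j := by unfold peak; positivity
  have ha : (0 : ℝ) < (pell j).1 := by exact_mod_cast hpa
  have hn : ((pell j).1 : ℝ) ^ 2 + (pell j).1 * (pell j).2 - 3 * (pell j).2 ^ 2 = 1 := by
    exact_mod_cast pell_norm j
  obtain ⟨s, hse⟩ : ∃ s, s = √(4 * (markoff j : ℝ) ^ 2 - 1) := ⟨_, rfl⟩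
  rw [← hse] at hs hs2 hs0 ⊢
  have hcN : (markoff j : ℝ) = (pell j).1 + 2 * (pell j).2 := by unfold markoff; push_cast; ring
  have hcM : (comarkoff j : ℝ) = (pell j).1 + 3 * (pell j).2 := by
    unfold comarkoff; push_cast; ring
  have hb : (0 : ℝ) ≤ (pell j).2 := by positivity
  have hM : (0 : ℝ) < comarkoff j := by rw [hcM]; positivity
  have hnorm : ((markoff j : ℝ) / s) ^ 2 + markoff j / s * (comarkoff j / s) +
      (comarkoff j / s) ^ 2 = 1 := by
    field_simp
    rw [hs2, hcN, hcM]
    linear_combination -hn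
  set x : ℝ := (s - (pell j).2) / comarkoff j with hx
  have hsb : ((pell j).2 : ℝ) < s := by
    refine lt_of_pow_lt_pow_left₀ 2 hs0.le ?_
    rw [hs2, hcN]; nlinarith
  have hx0 : 0 < x := div_pos (by linarith) hM
  have hfix : (word j).act x = x := by
    simp only [Branch.act, word]
    push_cast
    rw [div_eq_iff (by positivity)]
    have hMx : (comarkoff j : ℝ) * x = s - (pell j).2 := by rw [hx]; field_simp
    have h2 : (comarkoff j : ℝ) * (comarkoff j * x ^ 2 + 2 * (pell j).2 * x) =
        comarkoff j * (3 * markoff j) := by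
      have e : (comarkoff j : ℝ) * (comarkoff j * x ^ 2 + 2 * (pell j).2 * x) =
        (comarkoff j * x) ^ 2 + 2 * (pell j).2 * (comarkoff j * x) := by ring
      rw [e, hMx, hcM]
      rw [hcN] at hs2 ⊢
      linear_combination hs2 + hn
    have h3 := mul_left_cancel₀ hM.ne' h2
    rw [hcM, hcN] at h3
    linarith
  have hirr : Irrational x := by
    rintro ⟨q, hq⟩
    refine hs ⟨q * comarkoff j + (pell j).2, ?_⟩
    push_cast
    rw [hq, hx]; field_simp; ring
  have hpt : ((markoff j / s : ℝ) : ℂ) + ((comarkoff j / s : ℝ) : ℂ) * omega = arcPoint x := by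
    rw [eq_arcPoint (by positivity) (by positivity) hnorm]
    congr 1
    rw [hx]
    field_simp
    rw [hcN, hcM]; ring
  refine ⟨arcPoint x, arcPoint_mem hx0, hpt.symm, ?_⟩
  exact delta_eq_of_constEq hx0 hirr hpk (hc x hx0 hfix)

lemma sqrt_three_mul_peak (j : ℕ) :
    √3 * peak j = √(3 * (markoff j : ℝ) ^ 2 / (4 * (4 * (markoff j : ℝ) ^ 2 - 1))) := by
  rw [Real.sqrt_div (by positivity), Real.sqrt_mul (by norm_num), Real.sqrt_sq (by positivity),
    Real.sqrt_mul (by norm_num), show (4 : ℝ) = 2 ^ 2 by norm_num, Real.sqrt_sq (by norm_num), peak]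
  norm_num
  ring

lemma div_two_mul_sqrt {a b : ℝ} (ha : 0 ≤ a) : a / (2 * √b) = √(a ^ 2 / (4 * b)) := by
  rw [Real.sqrt_div (by positivity), Real.sqrt_sq ha, Real.sqrt_mul (by norm_num),
    show (4 : ℝ) = 2 ^ 2 by norm_num, Real.sqrt_sq (by norm_num)]

lemma half_eq : (1 / 2 : ℝ) = √(1 / 4) := by
  rw [show (1 / 4 : ℝ) = (1 / 2) ^ 2 by norm_num, Real.sqrt_sq (by norm_num)]

lemma five_div_eq : 5 / √133 = √(25 / 133) := by
  rw [Real.sqrt_div (by norm_num), show (25 : ℝ) = 5 ^ 2 by norm_num, Real.sqrt_sq (by norm_num)]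

lemma value_zero : √3 * peak 0 = 1 / 2 := by
  rw [sqrt_three_mul_peak, half_eq]; norm_num [markoff, pell]

lemma value_one : √3 * peak 1 = 5 / √133 := by
  rw [sqrt_three_mul_peak, five_div_eq]; norm_num [markoff, pell]

lemma value_two : √3 * peak 2 = 109 / (2 * √15841) := by
  rw [sqrt_three_mul_peak, div_two_mul_sqrt (by norm_num)]; norm_num [markoff, pell]

lemma value_three : √3 * peak 3 = 1189 / (2 * √1884961) := by
  rw [sqrt_three_mul_peak, div_two_mul_sqrt (by norm_num)]; norm_num [markoff, pell]

lemma value_two_fixed : √3 * (1 / √13) = √(3 / 13) := by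
  rw [Real.sqrt_div (by norm_num)]; ring

lemma exists_two_fixed_point : ∃ z ∈ arc,
    z = ((1 / 2 : ℝ) : ℂ) + (((-1 + √13) / 4 : ℝ) : ℂ) * omega ∧
      delta z = ENNReal.ofReal √(3 / 13) := by
  have h13 : √13 ^ 2 = (13 : ℝ) := Real.sq_sqrt (by norm_num)
  have h1 : 1 < √13 := Real.lt_sqrt_of_sq_lt (by norm_num)
  set x : ℝ := (√13 - 1) / 2 with hx
  have hx0 : 0 < x := by rw [hx]; linarith
  have hfix : branch₂.act x = x := by
    simp only [Branch.act, branch₂]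
    push_cast
    rw [div_eq_iff (by positivity), hx]
    linear_combination -h13 / 4
  have hirr : Irrational x := by
    have h : Irrational √(13 : ℝ) := by
      have := (show Nat.Prime 13 by norm_num).irrational_sqrt
      exact_mod_cast this
    rintro ⟨q, hq⟩
    refine h ⟨2 * q + 1, ?_⟩
    push_cast
    rw [hq, hx]; ring
  have hpt : ((1 / 2 : ℝ) : ℂ) + (((-1 + √13) / 4 : ℝ) : ℂ) * omega = arcPoint x := by
    rw [eq_arcPoint (by norm_num) (by linarith) (by linear_combination h13 / 16)]
    congr 1
    rw [div_eq_iff (by linarith), hx]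
    linear_combination -h13 / 8
  refine ⟨arcPoint x, arcPoint_mem hx0, hpt.symm, ?_⟩
  rw [← value_two_fixed]
  exact delta_eq_of_constEq hx0 hirr (by positivity) (constEq_of_fixed_two hx0 hfix)

lemma delta_arcPoint_cases {x : ℝ} (hx : 0 < x) :
    delta (arcPoint x) = ENNReal.ofReal (1 / 2) ∨ delta (arcPoint x) = ENNReal.ofReal √(3 / 13) ∨
    delta (arcPoint x) = ENNReal.ofReal (5 / √133) ∨
    delta (arcPoint x) = ENNReal.ofReal (109 / (2 * √15841)) ∨
    delta (arcPoint x) ≤ ENNReal.ofReal (1189 / (2 * √1884961)) := by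
  by_cases hi : Irrational x
  · have hpos : ∀ j, 0 < peak j := fun j => by
      have := quarter_le_peak j
      linarith
    rw [← value_zero, ← value_one, ← value_two, ← value_three, ← value_two_fixed]
    rcases inSpectrum_of_irrational hx hi with h | h | h | h | h
    · exact Or.inl (delta_eq_of_constEq hx hi (hpos _) h)
    · exact Or.inr (Or.inl (delta_eq_of_constEq hx hi (by positivity) h))
    · exact Or.inr (Or.inr (Or.inl (delta_eq_of_constEq hx hi (hpos _) h)))
    · exact Or.inr (Or.inr (Or.inr (Or.inl (delta_eq_of_constEq hx hi (hpos _) h))))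
    · exact Or.inr (Or.inr (Or.inr (Or.inr (delta_le_of_constLE hx h))))
  · right; right; right; right
    rw [delta_eq_zero_of_rational hx hi]
    exact zero_le

lemma delta_eq_top_iff {z : ℂ} (hz : z ∈ arc) : delta z = ∞ ↔ z = 1 ∨ z = omega := by
  constructor
  · intro h
    rcases arc_cases hz with h1 | h1 | ⟨x, hx, rfl⟩
    · exact Or.inl h1
    · exact Or.inr h1
    · exfalso
      rcases delta_arcPoint_cases hx with h' | h' | h' | h' | h' <;> rw [h] at h'
      · exact ENNReal.ofReal_ne_top h'.symm
      · exact ENNReal.ofReal_ne_top h'.symm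
      · exact ENNReal.ofReal_ne_top h'.symm
      · exact ENNReal.ofReal_ne_top h'.symm
      · exact ENNReal.ofReal_ne_top (top_le_iff.1 h')
  · rintro (rfl | rfl)
    · exact delta_one
    · exact delta_omega

lemma values_cases {v : ℝ≥0∞} (hv : v ∈ values) :
    v = ENNReal.ofReal (1 / 2) ∨ v = ENNReal.ofReal √(3 / 13) ∨
    v = ENNReal.ofReal (5 / √133) ∨ v = ENNReal.ofReal (109 / (2 * √15841)) ∨
    v ≤ ENNReal.ofReal (1189 / (2 * √1884961)) := by
  obtain ⟨z, hz, rfl, hne⟩ := hv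
  rcases arc_cases hz with rfl | rfl | ⟨x, hx, rfl⟩
  · exact absurd delta_one hne
  · exact absurd delta_omega hne
  · exact delta_arcPoint_cases hx

lemma mem_values {z : ℂ} {r : ℝ} (hz : z ∈ arc) (h : delta z = ENNReal.ofReal r) :
    ENNReal.ofReal r ∈ values :=
  ⟨z, hz, h, ENNReal.ofReal_ne_top⟩

end EisensteinSpectrum

theorem theorem1p1 :
    -- the value is infinite at the two end points of the arc and nowhere else
    (∀ z ∈ Eisenstein.arc, Eisenstein.delta z = ∞ ↔ z = 1 ∨ z = Eisenstein.omega) ∧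
    -- the five largest finite values, in decreasing order
    IsGreatest Eisenstein.values (ENNReal.ofReal (1 / 2)) ∧
    IsGreatest {x ∈ Eisenstein.values | x < ENNReal.ofReal (1 / 2)}
      (ENNReal.ofReal √(3 / 13)) ∧
    IsGreatest {x ∈ Eisenstein.values | x < ENNReal.ofReal √(3 / 13)}
      (ENNReal.ofReal (5 / √133)) ∧
    IsGreatest {x ∈ Eisenstein.values | x < ENNReal.ofReal (5 / √133)}
      (ENNReal.ofReal (109 / (2 * √15841))) ∧
    IsGreatest {x ∈ Eisenstein.values | x < ENNReal.ofReal (109 / (2 * √15841))}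
      (ENNReal.ofReal (1189 / (2 * √1884961))) ∧
    -- explicit points of the arc that attain them
    (∃ z ∈ Eisenstein.arc,
      z = ((1 / √3 : ℝ) : ℂ) + ((1 / √3 : ℝ) : ℂ) * Eisenstein.omega ∧
      Eisenstein.delta z = ENNReal.ofReal (1 / 2)) ∧
    (∃ z ∈ Eisenstein.arc,
      z = ((1 / 2 : ℝ) : ℂ) + (((-1 + √13) / 4 : ℝ) : ℂ) * Eisenstein.omega ∧
      Eisenstein.delta z = ENNReal.ofReal √(3 / 13)) ∧
    (∃ z ∈ Eisenstein.arc,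
      z = ((10 / √399 : ℝ) : ℂ) + ((13 / √399 : ℝ) : ℂ) * Eisenstein.omega ∧
      Eisenstein.delta z = ENNReal.ofReal (5 / √133)) ∧
    (∃ z ∈ Eisenstein.arc,
      z = ((109 / √47523 : ℝ) : ℂ) + ((142 / √47523 : ℝ) : ℂ) * Eisenstein.omega ∧
      Eisenstein.delta z = ENNReal.ofReal (109 / (2 * √15841))) ∧
    (∃ z ∈ Eisenstein.arc,
      z = ((1189 / √5654883 : ℝ) : ℂ) + ((1549 / √5654883 : ℝ) : ℂ) * Eisenstein.omega ∧
      Eisenstein.delta z = ENNReal.ofReal (1189 / (2 * √1884961))) := by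
  have lt₂ : ENNReal.ofReal √(3 / 13) < ENNReal.ofReal (1 / 2) := by
    rw [ENNReal.ofReal_lt_ofReal_iff (by norm_num), EisensteinSpectrum.half_eq]
    exact Real.sqrt_lt_sqrt (by norm_num) (by norm_num)
  have lt₃ : ENNReal.ofReal (5 / √133) < ENNReal.ofReal √(3 / 13) := by
    rw [ENNReal.ofReal_lt_ofReal_iff (by positivity), EisensteinSpectrum.five_div_eq]
    exact Real.sqrt_lt_sqrt (by norm_num) (by norm_num)
  have lt₄ : ENNReal.ofReal (109 / (2 * √15841)) < ENNReal.ofReal (5 / √133) := by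
    rw [ENNReal.ofReal_lt_ofReal_iff (by positivity), EisensteinSpectrum.five_div_eq,
      EisensteinSpectrum.div_two_mul_sqrt (by norm_num)]
    exact Real.sqrt_lt_sqrt (by norm_num) (by norm_num)
  have lt₅ : ENNReal.ofReal (1189 / (2 * √1884961)) < ENNReal.ofReal (109 / (2 * √15841)) := by
    rw [ENNReal.ofReal_lt_ofReal_iff (by positivity),
      EisensteinSpectrum.div_two_mul_sqrt (by norm_num),
      EisensteinSpectrum.div_two_mul_sqrt (by norm_num)]
    exact Real.sqrt_lt_sqrt (by norm_num) (by norm_num)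
  have p₁ := EisensteinSpectrum.exists_peak_point
    (fun _ hx h => EisensteinSpectrum.constEq_of_fixed_word_zero hx h)
  have p₂ := EisensteinSpectrum.exists_two_fixed_point
  have p₃ := EisensteinSpectrum.exists_peak_point
    (fun _ hx h => EisensteinSpectrum.constEq_of_fixed_word_one hx h)
  have p₄ := EisensteinSpectrum.exists_peak_point
    (fun _ hx h => EisensteinSpectrum.constEq_of_fixed_word_two hx h)
  have p₅ := EisensteinSpectrum.exists_peak_point
    (fun _ hx h => EisensteinSpectrum.constEq_of_fixed_word_three hx h)
  rw [EisensteinSpectrum.value_zero] at p₁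
  rw [EisensteinSpectrum.value_one] at p₃
  rw [EisensteinSpectrum.value_two] at p₄
  rw [EisensteinSpectrum.value_three] at p₅
  have e₁ : EisensteinSpectrum.markoff 0 = 1 ∧ EisensteinSpectrum.comarkoff 0 = 1 := by decide
  have e₃ : EisensteinSpectrum.markoff 1 = 10 ∧ EisensteinSpectrum.comarkoff 1 = 13 := by decide
  have e₄ : EisensteinSpectrum.markoff 2 = 109 ∧ EisensteinSpectrum.comarkoff 2 = 142 := by decide
  have e₅ : EisensteinSpectrum.markoff 3 = 1189 ∧ EisensteinSpectrum.comarkoff 3 = 1549 := by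
    decide
  rw [e₁.1, e₁.2, show (4 * ((1 : ℕ) : ℝ) ^ 2 - 1) = 3 by norm_num, Nat.cast_one] at p₁
  rw [e₃.1, e₃.2, show (4 * ((10 : ℕ) : ℝ) ^ 2 - 1) = 399 by norm_num, Nat.cast_ofNat,
    Nat.cast_ofNat] at p₃
  rw [e₄.1, e₄.2, show (4 * ((109 : ℕ) : ℝ) ^ 2 - 1) = 47523 by norm_num, Nat.cast_ofNat,
    Nat.cast_ofNat] at p₄
  rw [e₅.1, e₅.2, show (4 * ((1189 : ℕ) : ℝ) ^ 2 - 1) = 5654883 by norm_num, Nat.cast_ofNat,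
    Nat.cast_ofNat] at p₅
  refine ⟨fun z hz => EisensteinSpectrum.delta_eq_top_iff hz, ⟨?_, ?_⟩, ⟨⟨?_, lt₂⟩, ?_⟩,
    ⟨⟨?_, lt₃⟩, ?_⟩, ⟨⟨?_, lt₄⟩, ?_⟩, ⟨⟨?_, lt₅⟩, ?_⟩, p₁, p₂, p₃, p₄, p₅⟩
  · obtain ⟨z, hz, -, h⟩ := p₁
    exact EisensteinSpectrum.mem_values hz h
  · intro v hv
    rcases EisensteinSpectrum.values_cases hv with rfl | rfl | rfl | rfl | h
    · exact le_rfl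
    · exact lt₂.le
    · exact (lt₃.trans lt₂).le
    · exact (lt₄.trans (lt₃.trans lt₂)).le
    · exact h.trans (lt₅.trans (lt₄.trans (lt₃.trans lt₂))).le
  · obtain ⟨z, hz, -, h⟩ := p₂
    exact EisensteinSpectrum.mem_values hz h
  · rintro v ⟨hv, hlt⟩
    rcases EisensteinSpectrum.values_cases hv with rfl | rfl | rfl | rfl | h
    · exact absurd hlt (lt_irrefl _)
    · exact le_rfl
    · exact lt₃.le
    · exact (lt₄.trans lt₃).le
    · exact h.trans (lt₅.trans (lt₄.trans lt₃)).le
  · obtain ⟨z, hz, -, h⟩ := p₃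
    exact EisensteinSpectrum.mem_values hz h
  · rintro v ⟨hv, hlt⟩
    rcases EisensteinSpectrum.values_cases hv with rfl | rfl | rfl | rfl | h
    · exact absurd (hlt.trans lt₂) (lt_irrefl _)
    · exact absurd hlt (lt_irrefl _)
    · exact le_rfl
    · exact lt₄.le
    · exact h.trans (lt₅.trans lt₄).le
  · obtain ⟨z, hz, -, h⟩ := p₄
    exact EisensteinSpectrum.mem_values hz h
  · rintro v ⟨hv, hlt⟩
    rcases EisensteinSpectrum.values_cases hv with rfl | rfl | rfl | rfl | h
    · exact absurd (hlt.trans (lt₃.trans lt₂)) (lt_irrefl _)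
    · exact absurd (hlt.trans lt₃) (lt_irrefl _)
    · exact absurd hlt (lt_irrefl _)
    · exact le_rfl
    · exact h.trans lt₅.le
  · obtain ⟨z, hz, -, h⟩ := p₅
    exact EisensteinSpectrum.mem_values hz h
  · rintro v ⟨hv, hlt⟩
    rcases EisensteinSpectrum.values_cases hv with rfl | rfl | rfl | rfl | h
    · exact absurd (hlt.trans (lt₄.trans (lt₃.trans lt₂))) (lt_irrefl _)
    · exact absurd (hlt.trans (lt₄.trans lt₃)) (lt_irrefl _)
    · exact absurd (hlt.trans lt₄) (lt_irrefl _)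
    · exact absurd hlt (lt_irrefl _)
    · exact h
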